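/- Identify $\mathbb{R}^2$ with $\mathbb{C}$, with Lebesgue measure $dw$. For a measurable $g$ let $$\mathcal{M}g(x)=\sup_{r>0}\frac1{|B(x,r)|}\int_{B(x,r)}|g(y)|\,dy\in[0,\infty]$$ be its Hardy–Littlewood maximal function. For $f\in L^p(\mathbb{R}^2)$, $1\le p\le 2$, let $\widehat f$ denote its Fourier transform, normalized by $\widehat f(\xi)=\int e^{-ix\cdot\xi}f(x)\,dx$ for $f\in L^1$, and extended to $L^1+L^2\supset L^p$ by Plancherel's theorem. Let $\overline\partial^{-1}$ be the solid Cauchy transform $$(\overline\partial^{-1}f)(z)=\frac1\pi\int\frac{f(w)}{z-w}\,dw:=\lim_{R\to\infty}\frac1\pi\int_{|w|<R}\frac{f(w)}{z-w}\,dw .$$ **Theorem.** There is an absolute constant $C$ such that for all $p\in(1,2]$ and all $f\in L^p(\mathbb{R}^2)$ $$\left|(\overline\partial^{-1}f)(x)\right|\le C\,\bigl(\mathcal{M}f(x)\bigr)^{1/2}\bigl(\mathcal{M}\widehat f(0)\bigr)^{1/2}\qquad\text{for every } x .$$ Here $\overline\partial^{-1}f$ is well defined in the following sense. If $p<2$,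 the integral $\int f(w)/(z-w)\,dw$ converges absolutely for almost every $z$, and $(\overline\partial^{-1}f)(z)$ is $1/\pi$ times its value. If $p\le 2$ and $\mathcal{M}\widehat f(0)<\infty$, then for almost every $z$ the function $w\mapsto f(w)/(z-w)$ is integrable over every disc $|w|<R$, and the limit defining $(\overline\partial^{-1}f)(z)$ exists. (The right-hand side is read in $[0,\infty]$ with $0\cdot\infty=0$; at a point where the defining limit does not exist, the left-hand side is assigned an arbitrary finite value, and the estimate there says only that the right-hand side dominates it.) -/

import Mathlib

open MeasureTheory Filter Topology Metric
open scoped ENNReal NNReal FourierTransform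

noncomputable section

namespace DBar

/-- The Hardy-Littlewood maximal function
`M f (x) = sup_{r > 0} |B(x,r)|⁻¹ ∫_{B(x,r)} |f(y)| dy`, with values in `[0, ∞]`.
The plane is identified with `ℂ`, with Lebesgue measure. -/
def maximalFunction (f : ℂ → ℂ) (x : ℂ) : ℝ≥0∞ :=
  ⨆ (r : ℝ) (_ : 0 < r), (volume (ball x r))⁻¹ * ∫⁻ y in ball x r, ‖f y‖ₑ

/-- The part of `f` where `|f| > 1`. -/
def highPart (f : ℂ → ℂ) : ℂ → ℂ := {w : ℂ | 1 < ‖f w‖}.indicator f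

/-- The part of `f` where `|f| ≤ 1`. -/
def lowPart (f : ℂ → ℂ) : ℂ → ℂ := {w : ℂ | ‖f w‖ ≤ 1}.indicator f

theorem highPart_add_lowPart (f : ℂ → ℂ) (w : ℂ) : highPart f w + lowPart f w = f w := by
  by_cases h : 1 < ‖f w‖
  · simp [highPart, lowPart, h, not_le.mpr h]
  · simp [highPart, lowPart, h, not_lt.mp h]

theorem integrable_highPart {f : ℂ → ℂ} {p : ℝ≥0∞} (h1 : 1 ≤ p) (h2 : p ≤ 2)
    (hf : MemLp f p volume) : Integrable (highPart f) volume := by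
  have hm : NullMeasurableSet {w : ℂ | 1 < ‖f w‖} volume :=
    nullMeasurableSet_lt aemeasurable_const hf.1.norm.aemeasurable
  have hpt : p ≠ ∞ := ne_top_of_le_ne_top (by simp) h2
  have hp1 : 1 ≤ p.toReal := by
    simpa using ENNReal.toReal_mono hpt h1
  refine Integrable.mono' (hf.integrable_norm_rpow (by positivity) hpt)
    (hf.1.indicator₀ hm) (Eventually.of_forall fun w => ?_)
  by_cases h : 1 < ‖f w‖
  · simp only [highPart, Set.indicator, Set.mem_ofPred_eq, h, if_true]
    exact Real.self_le_rpow_of_one_le h.le hp1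
  · simp only [highPart, Set.indicator, Set.mem_ofPred_eq, h, if_false, norm_zero]
    positivity

theorem memLp_lowPart {f : ℂ → ℂ} {p : ℝ≥0∞} (h1 : 1 ≤ p) (h2 : p ≤ 2)
    (hf : MemLp f p volume) : MemLp (lowPart f) 2 volume := by
  have hm : NullMeasurableSet {w : ℂ | ‖f w‖ ≤ 1} volume :=
    nullMeasurableSet_le hf.1.norm.aemeasurable aemeasurable_const
  have hpt : p ≠ ∞ := ne_top_of_le_ne_top (by simp) h2
  have hp2 : p.toReal ≤ 2 := by
    simpa using ENNReal.toReal_mono (by simp) h2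
  have hp1 : 1 ≤ p.toReal := by
    simpa using ENNReal.toReal_mono hpt h1
  have hs := hf.1.indicator₀ hm
  refine (memLp_two_iff_integrable_sq_norm hs).2 ?_
  refine Integrable.mono' (hf.integrable_norm_rpow (by positivity) hpt)
    (hs.norm.pow 2) (Eventually.of_forall fun w => ?_)
  by_cases h : ‖f w‖ ≤ 1
  · simp only [Set.indicator, Set.mem_ofPred_eq, h, if_true]
    rw [Real.norm_of_nonneg (by positivity), ← Real.rpow_natCast]
    rcases (norm_nonneg (f w)).eq_or_lt with h0 | h0
    · rw [← h0, Real.zero_rpow (by norm_num), Real.zero_rpow (by positivity)]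
    · exact Real.rpow_le_rpow_of_exponent_ge h0 h (by simpa using hp2)
  · simp only [Set.indicator, Set.mem_ofPred_eq, h, if_false]
    simp
    positivity

/-- The Fourier transform, with the normalization `∫ e^{-i x·ξ} f(x) dx`, of a function
`f ∈ L^p(ℝ²)`, `1 ≤ p ≤ 2`, as a function (defined up to null sets): the transform on
`L¹ + L²`, that is, the Fourier integral on the `L¹` part and the Plancherel extension on
the `L²` part. Mathlib's `𝓕` has the phase `e^{-2πi x·ξ}`, whence the rescaling of `ξ`. -/
def fourierLp {f : ℂ → ℂ} {p : ℝ≥0∞} (h1 : 1 ≤ p) (h2 : p ≤ 2) (hf : MemLp f p volume) :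
    ℂ → ℂ := fun ξ =>
  𝓕 (highPart f) ((2 * Real.pi)⁻¹ • ξ) +
    (𝓕 ((memLp_lowPart h1 h2 hf).toLp (lowPart f)) : Lp ℂ 2 (volume : Measure ℂ))
      ((2 * Real.pi)⁻¹ • ξ)

/-- The Cauchy integral of the truncation of `f` to the disc `|w| < R`:
`π⁻¹ ∫_{|w| < R} f(w) / (z - w) dw`. -/
def truncatedCauchy (f : ℂ → ℂ) (R : ℝ) (z : ℂ) : ℂ :=
  (Real.pi : ℂ)⁻¹ * ∫ w in ball (0 : ℂ) R, f w / (z - w)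

/-- The solid Cauchy transform `π⁻¹ ∫ f(w) / (z - w) dw`, the integral being taken as the
limit of the integrals over the discs `|w| < R` as `R → ∞` (so that it extends to
`f ∈ L²`, where the integral need not converge absolutely at infinity). -/
def solidCauchy (f : ℂ → ℂ) (z : ℂ) : ℂ :=
  limUnder atTop fun R : ℝ => truncatedCauchy f R z

end DBar

end

/-!
The Cauchy kernel is split at a scale `r` around the pole `z`. The near part, the Cauchy kernel
times the Gaussian `exp (-|w - z|² / r²)`, is dominated by a superposition of normalised indicators
of discs around `z`, so that its contribution is at most a constant times `r * M f z`
(`lintegral_gaussian_potential_le`, `norm_dampedCauchy_le`). The far part is treated on the Fourier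
side. With a second Gaussian cutoff at a large scale `R`, the far kernel is the difference of two
Gaussians divided by the complex variable (`gaussQuot`), and so is its Fourier transform
(`fourier_gaussQuot`). The multiplication formula (`integral_fourierLp_mul_eq`) turns the far part
into an integral of the Fourier transform of `f` against a kernel dominated, uniformly in `R`, by
`exp (-r² |ξ|² / 4) / |ξ|`. This is again a Gaussian potential, now at the origin and at the scale
`2 / r`, so that its contribution is at most a constant times `M (fourierLp f) 0 / r`, and dominated
convergence gives the limit `R → ∞` (`exists_tendsto_dampedCauchy`). Choosing `r` to balance the two
contributions gives the geometric mean of the two maximal functions (`norm_solidCauchy_le`).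

The limit that defines the solid Cauchy transform uses the sharp cutoff `|w| < R` instead of a
Gaussian one. The difference of the two cutoffs tends to zero by dominated convergence for the
integrable part of `f`; for its square integrable part, the kernel of the difference is dominated by
an `L²`-normalised Gaussian of width `R`, which tends weakly to zero
(`tendsto_truncated_sub_damped`). Besides the finiteness of `M (fourierLp f) 0`, the convergence
needs only that the Cauchy kernel is integrable against the part of `f` where `|f| > 1`; this holds
almost everywhere, and at every point where `M f` is finite. If one of the two maximal functions
vanishes, then `f = 0` almost everywhere, by injectivity of the Fourier transform in the second case
(`ae_eq_zero_of_fourierLp_ae_eq_zero`).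
-/

noncomputable section

namespace DBar

/-! ### Gaussian-damped potentials and the maximal function -/

/-- The radial profile `exp (-u² / ρ²) / u` is dominated by a superposition over `t > 0` of the
indicators of `u < t`, with a density decaying fast enough that `t²` times it is integrable. -/
theorem exp_neg_sq_div_le_layer {u ρ : ℝ} (hu : 0 ≤ u) (hρ : 0 < ρ) :
    ENNReal.ofReal (Real.exp (-(u ^ 2 / ρ ^ 2)) / u) ≤
      ∫⁻ t in Set.Ioi (0 : ℝ), (Set.Ioi u).indicator
        (fun t => ENNReal.ofReal (16 / (t ^ 2 * (1 + (t / ρ) ^ 2)))) t := by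
  rcases hu.eq_or_lt with rfl | hu
  · simp
  have key : Real.exp (-(u ^ 2 / ρ ^ 2)) / u ≤ 16 / ((2 * u) ^ 2 * (1 + (2 * u / ρ) ^ 2)) * u := by
    have h1 : Real.exp (-(u ^ 2 / ρ ^ 2)) ≤ 1 / (1 + (u / ρ) ^ 2) := by
      rw [Real.exp_neg, ← one_div]
      gcongr
      have := Real.add_one_le_exp (u ^ 2 / ρ ^ 2)
      rw [div_pow]; linarith
    calc Real.exp (-(u ^ 2 / ρ ^ 2)) / u ≤ 1 / (1 + (u / ρ) ^ 2) / u := by gcongr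
      _ ≤ _ := by
        have h2 : 2 * u / ρ = 2 * (u / ρ) := by ring
        rw [h2]
        set v := u / ρ
        rw [div_div, div_mul_eq_mul_div, div_le_div_iff₀ (by positivity) (by positivity)]
        nlinarith [pow_pos hu 2, mul_nonneg (sq_nonneg v) (pow_pos hu 2).le]
  -- The density is decreasing, so the integral over `(u, 2u]` is at least `u` times its value
  -- at `2u`.
  calc ENNReal.ofReal (Real.exp (-(u ^ 2 / ρ ^ 2)) / u)
      ≤ ENNReal.ofReal (16 / ((2 * u) ^ 2 * (1 + (2 * u / ρ) ^ 2)) * u) :=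
        ENNReal.ofReal_le_ofReal key
    _ = ∫⁻ t in Set.Ioc u (2 * u),
          ENNReal.ofReal (16 / ((2 * u) ^ 2 * (1 + (2 * u / ρ) ^ 2))) := by
        rw [setLIntegral_const, Real.volume_Ioc, ← ENNReal.ofReal_mul (by positivity)]
        congr 2; ring
    _ ≤ ∫⁻ t in Set.Ioc u (2 * u), (Set.Ioi u).indicator
        (fun t => ENNReal.ofReal (16 / (t ^ 2 * (1 + (t / ρ) ^ 2)))) t := by
        refine setLIntegral_mono' measurableSet_Ioc fun t ht => ?_
        rw [Set.indicator_of_mem (show t ∈ Set.Ioi u from ht.1)]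
        have h0 : 0 < t := hu.trans ht.1
        have := ht.2
        gcongr
    _ ≤ _ := lintegral_mono_set fun t ht => hu.trans ht.1

/-- A potential with kernel `exp (-|y|² / ρ²) / |y|` is controlled by the maximal function,
because the kernel is dominated by a superposition of indicators of centred balls. -/
theorem lintegral_gaussian_potential_le {h : ℂ → ℂ} (hh : AEStronglyMeasurable h volume)
    (x : ℂ) {ρ : ℝ} (hρ : 0 < ρ) :
    ∫⁻ y, ‖h y‖ₑ * ENNReal.ofReal (Real.exp (-(‖y - x‖ ^ 2 / ρ ^ 2)) / ‖y - x‖) ≤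
      ENNReal.ofReal (8 * Real.pi ^ 2 * ρ) * maximalFunction h x := by
  set φ : ℝ → ℝ≥0∞ := fun t => ENNReal.ofReal (16 / (t ^ 2 * (1 + (t / ρ) ^ 2)))
  have hφ : Measurable φ := by fun_prop
  set M := maximalFunction h x
  have hball : ∀ t : ℝ, 0 < t → ∫⁻ y in ball x t, ‖h y‖ₑ ≤ volume (ball x t) * M := by
    intro t ht
    have h1 : (volume (ball x t))⁻¹ * ∫⁻ y in ball x t, ‖h y‖ₑ ≤ M :=
      le_iSup₂ (f := fun (r : ℝ) (_ : 0 < r) => (volume (ball x r))⁻¹ * ∫⁻ y in ball x r, ‖h y‖ₑ)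
        t ht
    rwa [ENNReal.inv_mul_le_iff (measure_ball_pos _ _ ht).ne' measure_ball_lt_top.ne] at h1
  have hmeas : AEMeasurable (Function.uncurry fun (y : ℂ) (t : ℝ) =>
      ‖h y‖ₑ * (Set.Ioi ‖y - x‖).indicator φ t) (volume.prod (volume.restrict (Set.Ioi 0))) := by
    refine AEMeasurable.mul ?_ ?_
    · exact (hh.enorm).comp_quasiMeasurePreserving Measure.quasiMeasurePreserving_fst
    · have : (Function.uncurry fun (y : ℂ) (t : ℝ) => (Set.Ioi ‖y - x‖).indicator φ t) =
          {q : ℂ × ℝ | ‖q.1 - x‖ < q.2}.indicator (fun q => φ q.2) := by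
        ext ⟨y, t⟩; simp [Set.indicator]
      change AEMeasurable (Function.uncurry fun (y : ℂ) (t : ℝ) =>
        (Set.Ioi ‖y - x‖).indicator φ t) _
      rw [this]
      exact ((hφ.comp measurable_snd).indicator
        (measurableSet_lt (by fun_prop) (by fun_prop))).aemeasurable
  calc ∫⁻ y, ‖h y‖ₑ * ENNReal.ofReal (Real.exp (-(‖y - x‖ ^ 2 / ρ ^ 2)) / ‖y - x‖)
      ≤ ∫⁻ y, ‖h y‖ₑ * ∫⁻ t in Set.Ioi (0 : ℝ), (Set.Ioi ‖y - x‖).indicator φ t := by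
        gcongr with y
        exact exp_neg_sq_div_le_layer (norm_nonneg _) hρ
    _ = ∫⁻ y, ∫⁻ t in Set.Ioi (0 : ℝ), ‖h y‖ₑ * (Set.Ioi ‖y - x‖).indicator φ t := by
        congr with y
        rw [lintegral_const_mul _ (hφ.indicator measurableSet_Ioi)]
    _ = ∫⁻ t in Set.Ioi (0 : ℝ), ∫⁻ y, ‖h y‖ₑ * (Set.Ioi ‖y - x‖).indicator φ t :=
        lintegral_lintegral_swap hmeas
    _ = ∫⁻ t in Set.Ioi (0 : ℝ), φ t * ∫⁻ y in ball x t, ‖h y‖ₑ := by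
        congr with t
        rw [← lintegral_const_mul'' _ hh.enorm.restrict, ← lintegral_indicator measurableSet_ball]
        congr with y
        by_cases hy : ‖y - x‖ < t
        · simp [Set.indicator, mem_ball, dist_eq_norm, hy, mul_comm]
        · simp [Set.indicator, mem_ball, dist_eq_norm, hy]
    _ ≤ ∫⁻ t in Set.Ioi (0 : ℝ), ENNReal.ofReal (16 * Real.pi * (1 + (ρ⁻¹ * t) ^ 2)⁻¹) * M := by
        refine setLIntegral_mono' measurableSet_Ioi fun t ht => ?_
        have ht : 0 < t := ht
        grw [hball t ht, ← mul_assoc]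
        gcongr
        rw [Complex.volume_ball, ← ENNReal.ofReal_pow ht.le, ← ENNReal.ofReal_coe_nnreal,
          NNReal.coe_real_pi, ← ENNReal.ofReal_mul (by positivity),
          ← ENNReal.ofReal_mul (by positivity)]
        refine (congrArg _ ?_).le
        field_simp
    _ = _ := by
        rw [lintegral_mul_const _ (by fun_prop)]
        congr 1
        rw [← ofReal_integral_eq_lintegral_ofReal]
        · congr 1
          rw [integral_const_mul,
            integral_comp_mul_left_Ioi (fun t => (1 + t ^ 2)⁻¹) 0 (inv_pos.2 hρ), mul_zero,
            integral_Ioi_inv_one_add_sq]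
          simp
          ring
        · exact ((integrable_inv_one_add_sq.comp_mul_left' (inv_ne_zero hρ.ne')).const_mul
            _).integrableOn
        · exact Eventually.of_forall fun t => by positivity

theorem maximalFunction_le_of_norm_le_one {h : ℂ → ℂ} (hh : ∀ y, ‖h y‖ ≤ 1) (x : ℂ) :
    maximalFunction h x ≤ 1 := by
  refine iSup₂_le fun r hr => ?_
  rw [ENNReal.inv_mul_le_iff (measure_ball_pos _ _ hr).ne' measure_ball_lt_top.ne, mul_one]
  calc ∫⁻ y in ball x r, ‖h y‖ₑ ≤ ∫⁻ y in ball x r, 1 := by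
        gcongr with y
        rw [← ofReal_norm]
        exact ENNReal.ofReal_le_one.2 (hh y)
    _ = _ := by simp

/-! ### Fourier duality on `L¹ + L²` -/

theorem integral_fourier_mul_eq_of_integrable {f g : ℂ → ℂ} (hf : Integrable f volume)
    (hg : Integrable g volume) : ∫ ξ, 𝓕 f ξ * g ξ = ∫ w, f w * 𝓕 g w := by
  simpa using! (VectorFourier.integral_fourierIntegral_smul_eq_flip (L := innerₗ ℂ)
    Real.continuous_fourierChar continuous_inner hf hg)

theorem inner_toLp_conj {g : ℂ → ℂ} (hg : MemLp (fun w => (starRingEnd ℂ) (g w)) 2 volume)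
    (u : Lp ℂ 2 (volume : Measure ℂ)) :
    inner ℂ (hg.toLp _) u = ∫ w, u w * g w := by
  rw [L2.inner_def]
  refine integral_congr_ae ?_
  filter_upwards [hg.coeFn_toLp] with w hw
  simp [hw]

/-- The multiplication formula for the Plancherel extension, tested against a function whose
Fourier integral is square integrable. -/
theorem integral_fourier_Lp_mul_eq {g : ℂ → ℂ} (hg1 : Integrable g volume)
    (hg2 : MemLp g 2 volume) (hg3 : MemLp (𝓕 g) 2 volume) (u : Lp ℂ 2 (volume : Measure ℂ)) :
    ∫ ξ, (𝓕 u : Lp ℂ 2 (volume : Measure ℂ)) ξ * g ξ = ∫ w, u w * 𝓕 g w := by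
  rw [← inner_toLp_conj (g := g) hg2.star, ← inner_toLp_conj (g := 𝓕 g) hg3.star]
  -- Both sides are now inner products, hence continuous in `u`, and Schwartz functions are dense.
  refine DenseRange.induction_on (SchwartzMap.denseRange_toLpCLM (p := 2) (F := ℂ)
    (μ := (volume : Measure ℂ)) ENNReal.ofNat_ne_top) u ?_ ?_
  · refine isClosed_eq ?_ (by fun_prop)
    exact continuous_const.inner (FourierTransform.continuous_fourier)
  · intro φ
    rw [SchwartzMap.toLpCLM_apply, SchwartzMap.toLp_fourier_eq, inner_toLp_conj, inner_toLp_conj]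
    calc ∫ w, (𝓕 φ).toLp 2 volume w * g w = ∫ w, 𝓕 (φ : ℂ → ℂ) w * g w := by
          refine integral_congr_ae ?_
          filter_upwards [(𝓕 φ).coeFn_toLp 2 volume] with w hw
          rw [hw, SchwartzMap.fourier_coe]
      _ = ∫ w, φ w * 𝓕 g w := integral_fourier_mul_eq_of_integrable φ.integrable hg1
      _ = _ := by
          refine integral_congr_ae ?_
          filter_upwards [φ.coeFn_toLp 2 volume] with w hw
          rw [hw]

theorem quasiMeasurePreserving_smul {c : ℝ} (hc : c ≠ 0) :
    Measure.QuasiMeasurePreserving (fun ξ : ℂ => c • ξ) volume volume := by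
  refine ⟨by fun_prop, ?_⟩
  rw [Measure.map_addHaar_smul _ hc]
  exact Measure.smul_absolutelyContinuous

section Sum
variable {f : ℂ → ℂ} {p : ℝ≥0∞}

theorem fourierLp_smul (h1 : 1 ≤ p) (h2 : p ≤ 2) (hf : MemLp f p volume) (ξ : ℂ) :
    fourierLp h1 h2 hf ((2 * Real.pi) • ξ) = 𝓕 (highPart f) ξ +
      (𝓕 ((memLp_lowPart h1 h2 hf).toLp (lowPart f)) : Lp ℂ 2 (volume : Measure ℂ)) ξ := by
  simp only [fourierLp]
  rw [smul_smul, inv_mul_cancel₀ (by positivity), one_smul]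

theorem norm_fourier_le_integral_norm (g : ℂ → ℂ) (ξ : ℂ) : ‖𝓕 g ξ‖ ≤ ∫ w, ‖g w‖ :=
  VectorFourier.norm_fourierIntegral_le_integral_norm _ _ _ _ _

theorem continuous_fourier_of_integrable {g : ℂ → ℂ} (hg : Integrable g volume) :
    Continuous (𝓕 g) :=
  VectorFourier.fourierIntegral_continuous Real.continuous_fourierChar
    (by exact continuous_inner) hg

theorem integrable_mul_fourier_of_integrable {f g : ℂ → ℂ} (hf : Integrable f volume)
    (hg : Integrable g volume) : Integrable (fun w => f w * 𝓕 g w) volume :=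
  hf.mul_bdd (continuous_fourier_of_integrable hg).aestronglyMeasurable
    (Eventually.of_forall fun ξ => norm_fourier_le_integral_norm g ξ)

/-- The multiplication formula for the Fourier transform of a function in `L^p`. -/
theorem integral_fourierLp_mul_eq (h1 : 1 ≤ p) (h2 : p ≤ 2) (hf : MemLp f p volume) {g : ℂ → ℂ}
    (hg1 : Integrable g volume) (hg2 : MemLp g 2 volume) (hg3 : MemLp (𝓕 g) 2 volume) :
    ∫ ξ, fourierLp h1 h2 hf ((2 * Real.pi) • ξ) * g ξ = ∫ w, f w * 𝓕 g w := by
  have hH := integrable_highPart h1 h2 hf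
  have hL := memLp_lowPart h1 h2 hf
  set u := hL.toLp (lowPart f)
  have e1 : Integrable (fun ξ => 𝓕 (highPart f) ξ * g ξ) volume := by
    simpa [mul_comm] using integrable_mul_fourier_of_integrable hg1 hH
  have e2 : Integrable (fun ξ => (𝓕 u : Lp ℂ 2 (volume : Measure ℂ)) ξ * g ξ) volume :=
    (Lp.memLp (𝓕 u)).integrable_mul hg2
  have e3 := integrable_mul_fourier_of_integrable hH hg1
  have e4 : Integrable (fun ξ => lowPart f ξ * 𝓕 g ξ) volume := hL.integrable_mul hg3
  simp_rw [fourierLp_smul, add_mul]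
  rw [integral_add e1 e2, integral_fourier_mul_eq_of_integrable hH hg1,
    integral_fourier_Lp_mul_eq hg1 hg2 hg3]
  have : ∫ w, u w * 𝓕 g w = ∫ w, lowPart f w * 𝓕 g w := by
    refine integral_congr_ae ?_
    filter_upwards [hL.coeFn_toLp] with w hw
    rw [hw]
  rw [this, ← integral_add e3 e4]
  simp_rw [← add_mul, highPart_add_lowPart]

theorem aestronglyMeasurable_fourierLp (h1 : 1 ≤ p) (h2 : p ≤ 2) (hf : MemLp f p volume) :
    AEStronglyMeasurable (fourierLp h1 h2 hf) volume := by
  have hq := quasiMeasurePreserving_smul (c := (2 * Real.pi)⁻¹) (by positivity)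
  refine AEStronglyMeasurable.add ?_ ?_
  · have := continuous_fourier_of_integrable (integrable_highPart h1 h2 hf)
    exact (this.comp (by fun_prop)).aestronglyMeasurable
  · exact (Lp.memLp _).1.comp_quasiMeasurePreserving hq

/-- A function in `L^p`, `1 ≤ p ≤ 2`, is determined by its Fourier transform. -/
theorem ae_eq_zero_of_fourierLp_ae_eq_zero (h1 : 1 ≤ p) (h2 : p ≤ 2) (hf : MemLp f p volume)
    (h0 : ∀ᵐ ξ, fourierLp h1 h2 hf ξ = 0) : ∀ᵐ w, f w = 0 := by
  refine ae_eq_zero_of_integral_contDiff_smul_eq_zero (hf.locallyIntegrable h1) fun g hg hgc => ?_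
  have hg₁ : HasCompactSupport (Complex.ofRealCLM ∘ g) := hgc.comp_left rfl
  have hg₂ : ContDiff ℝ ((⊤ : ℕ∞) : WithTop ℕ∞) (Complex.ofRealCLM ∘ g) := by fun_prop
  set φ := hg₁.toSchwartzMap hg₂
  -- Every test function is the Fourier transform of a Schwartz function.
  have hφ : 𝓕 ((𝓕⁻ φ : SchwartzMap ℂ ℂ) : ℂ → ℂ) = φ := by
    rw [← SchwartzMap.fourier_coe]; simp
  have := integral_fourierLp_mul_eq h1 h2 hf (g := (𝓕⁻ φ : SchwartzMap ℂ ℂ))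
    (𝓕⁻ φ : SchwartzMap ℂ ℂ).integrable ((𝓕⁻ φ : SchwartzMap ℂ ℂ).memLp 2)
    (by rw [hφ]; exact φ.memLp 2)
  rw [hφ] at this
  have hq := quasiMeasurePreserving_smul (c := 2 * Real.pi) (by positivity)
  have hz : ∫ ξ, fourierLp h1 h2 hf ((2 * Real.pi) • ξ) * (𝓕⁻ φ : SchwartzMap ℂ ℂ) ξ = 0 := by
    rw [← integral_zero ℂ ℂ]
    refine integral_congr_ae ?_
    filter_upwards [hq.ae h0] with ξ hξ
    rw [hξ, zero_mul]
  rw [hz] at this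
  rw [this]
  refine integral_congr_ae (Eventually.of_forall fun w => ?_)
  simp [φ, mul_comm]

end Sum

/-! ### The Fourier transform of a difference of Gaussians divided by the variable -/

theorem integrable_exp_neg_mul_sq_norm {a : ℝ} (ha : 0 < a) :
    Integrable (fun ξ : ℂ => Real.exp (-a * ‖ξ‖ ^ 2)) volume := by
  have := (GaussianFourier.integrable_cexp_neg_mul_sq_norm_add (V := ℂ) (b := a)
    (by simpa) 0 0).norm
  refine this.congr (Eventually.of_forall fun ξ => ?_)
  simp [Complex.norm_exp, ← Complex.ofReal_pow]

theorem norm_mul_exp_le {a : ℝ} (ha : 0 < a) (ξ : ℂ) :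
    ‖ξ‖ * Real.exp (-a * ‖ξ‖ ^ 2) ≤ (1 + 2 / a) * Real.exp (-(a / 2) * ‖ξ‖ ^ 2) := by
  have h1 : Real.exp (-a * ‖ξ‖ ^ 2) =
      (Real.exp (a / 2 * ‖ξ‖ ^ 2))⁻¹ * Real.exp (-(a / 2) * ‖ξ‖ ^ 2) := by
    rw [← Real.exp_neg, ← Real.exp_add]; ring_nf
  rw [h1, ← mul_assoc]
  gcongr
  rw [mul_inv_le_iff₀ (Real.exp_pos _)]
  have h2 := Real.add_one_le_exp (a / 2 * ‖ξ‖ ^ 2)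
  set x := ‖ξ‖
  calc x ≤ 1 + x ^ 2 := by nlinarith [sq_nonneg (x - 1)]
    _ ≤ (1 + 2 / a) * (a / 2 * x ^ 2 + 1) := by
      have : (1 + 2 / a) * (a / 2 * x ^ 2 + 1) = 1 + x ^ 2 + (a / 2 * x ^ 2 + 2 / a) := by
        field_simp; ring
      rw [this]
      have : 0 ≤ a / 2 * x ^ 2 + 2 / a := by positivity
      linarith
    _ ≤ _ := by gcongr

/-- The difference of two centred Gaussians, divided by the complex variable. -/
def gaussQuot (a b : ℝ) (ξ : ℂ) : ℂ :=
  ((Real.exp (-a * ‖ξ‖ ^ 2) - Real.exp (-b * ‖ξ‖ ^ 2) : ℝ) : ℂ) / ξ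

theorem measurable_gaussQuot (a b : ℝ) : Measurable (gaussQuot a b) := by
  unfold gaussQuot; fun_prop

theorem norm_gaussQuot_le {a b : ℝ} (hab : a ≤ b) (ξ : ℂ) :
    ‖gaussQuot a b ξ‖ ≤ Real.exp (-a * ‖ξ‖ ^ 2) / ‖ξ‖ := by
  rw [gaussQuot, norm_div, Complex.norm_real, Real.norm_of_nonneg]
  · gcongr
    linarith [Real.exp_pos (-b * ‖ξ‖ ^ 2)]
  · rw [sub_nonneg]; gcongr

/-- A bound that sees the cancellation of the two Gaussians at the origin. -/
theorem norm_gaussQuot_le' {a b : ℝ} (ha : 0 < a) (hab : a ≤ b) (ξ : ℂ) :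
    ‖gaussQuot a b ξ‖ ≤ (b - a) * (1 + 2 / a) * Real.exp (-(a / 2) * ‖ξ‖ ^ 2) := by
  have h0 : ‖gaussQuot a b ξ‖ ≤ (b - a) * (‖ξ‖ * Real.exp (-a * ‖ξ‖ ^ 2)) := by
    rw [gaussQuot, norm_div, Complex.norm_real, Real.norm_of_nonneg]
    · rcases (norm_nonneg ξ).eq_or_lt with h | h
      · simp [← h]
      rw [div_le_iff₀ h]
      have h1 : Real.exp (-b * ‖ξ‖ ^ 2) =
          Real.exp (-a * ‖ξ‖ ^ 2) * Real.exp (-((b - a) * ‖ξ‖ ^ 2)) := by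
        rw [← Real.exp_add]; ring_nf
      have h2 := Real.add_one_le_exp (-((b - a) * ‖ξ‖ ^ 2))
      rw [h1]
      nlinarith [Real.exp_pos (-a * ‖ξ‖ ^ 2)]
    · rw [sub_nonneg]; gcongr
  have := sub_nonneg.2 hab
  grw [h0, norm_mul_exp_le ha, mul_assoc]

theorem integrable_gaussQuot {a b : ℝ} (ha : 0 < a) (hab : a ≤ b) :
    Integrable (gaussQuot a b) volume :=
  Integrable.mono' ((integrable_exp_neg_mul_sq_norm (half_pos ha)).const_mul _)
    (measurable_gaussQuot a b).aestronglyMeasurable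
    (Eventually.of_forall fun ξ => norm_gaussQuot_le' ha hab ξ)

theorem memLp_two_gaussQuot {a b : ℝ} (ha : 0 < a) (hab : a ≤ b) :
    MemLp (gaussQuot a b) 2 volume := by
  refine (memLp_two_iff_integrable_sq_norm (measurable_gaussQuot a b).aestronglyMeasurable).2 ?_
  refine Integrable.mono'
    ((integrable_exp_neg_mul_sq_norm ha).const_mul (((b - a) * (1 + 2 / a)) ^ 2))
    ((measurable_gaussQuot a b).norm.pow_const 2).aestronglyMeasurable
    (Eventually.of_forall fun ξ => ?_)
  rw [Real.norm_of_nonneg (by positivity)]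
  calc ‖gaussQuot a b ξ‖ ^ 2
      ≤ ((b - a) * (1 + 2 / a) * Real.exp (-(a / 2) * ‖ξ‖ ^ 2)) ^ 2 := by
        gcongr; exact norm_gaussQuot_le' ha hab ξ
    _ = _ := by
        rw [mul_pow, ← Real.exp_nat_mul]
        congr 2; push_cast; ring

theorem integrable_norm_mul_exp {a : ℝ} (ha : 0 < a) :
    Integrable (fun ξ : ℂ => ‖ξ‖ * Real.exp (-a * ‖ξ‖ ^ 2)) volume :=
  Integrable.mono' ((integrable_exp_neg_mul_sq_norm (half_pos ha)).const_mul _)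
    (by fun_prop) (Eventually.of_forall fun ξ => by
      rw [Real.norm_of_nonneg (by positivity)]; exact norm_mul_exp_le ha ξ)

/-- Differentiating the Fourier transform of a Gaussian gives that of its first moment. -/
theorem fourier_conj_mul_gaussian {s : ℝ} (hs : 0 < s) (w : ℂ) :
    𝓕 (fun ξ : ℂ => (starRingEnd ℂ) ξ * ((Real.exp (-s * ‖ξ‖ ^ 2) : ℝ) : ℂ)) w =
      -Complex.I * (starRingEnd ℂ) w *
        ((Real.pi ^ 2 / s ^ 2 * Real.exp (-Real.pi ^ 2 * ‖w‖ ^ 2 / s) : ℝ) : ℂ) := by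
  set f : ℂ → ℂ := fun ξ => ((Real.exp (-s * ‖ξ‖ ^ 2) : ℝ) : ℂ)
  have hfi : Integrable f volume := (integrable_exp_neg_mul_sq_norm hs).ofReal
  have hvf : Integrable (fun ξ => ‖ξ‖ * ‖f ξ‖) volume := by
    refine (integrable_norm_mul_exp hs).congr (Eventually.of_forall fun ξ => ?_)
    simp only [f, Complex.norm_real, Real.norm_of_nonneg (Real.exp_pos _).le]
  have hF : 𝓕 f = fun w : ℂ =>
      ((Real.pi / s * Real.exp (-Real.pi ^ 2 * ‖w‖ ^ 2 / s) : ℝ) : ℂ) := by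
    ext w
    have := fourier_gaussian_innerProductSpace (V := ℂ) (b := s) (by simpa) w
    simp only [Complex.finrank_real_complex] at this
    push_cast
    norm_num at this ⊢
    rw [← this]
    refine congrArg (fun u : ℂ → ℂ => 𝓕 u w) (funext fun ξ => ?_)
    simp [f]
  have hd := Real.hasFDerivAt_fourier hfi hvf w
  have hd' : HasFDerivAt (𝓕 f) (Complex.ofRealCLM ∘L ((Real.pi / s) •
      (Real.exp (-Real.pi ^ 2 * ‖w‖ ^ 2 / s) • ((-Real.pi ^ 2 / s) • (2 • innerSL ℝ w))))) w := by
    rw [hF]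
    refine Complex.ofRealCLM.hasFDerivAt.comp w ?_
    refine HasFDerivAt.const_mul (HasFDerivAt.exp ?_) _
    have := ((hasStrictFDerivAt_norm_sq (F := ℂ) w).hasFDerivAt.const_mul (-Real.pi ^ 2 / s))
    refine this.congr_of_eventuallyEq (Eventually.of_forall fun x => ?_)
    ring
  have hu := hd.unique hd'
  have hint : Integrable (VectorFourier.fourierSMulRight (innerSL ℝ) f) volume := by
    refine (hvf.const_mul (2 * Real.pi * ‖innerSL ℝ (E := ℂ)‖)).mono'
      hfi.1.fourierSMulRight (Eventually.of_forall fun ξ => ?_)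
    have := VectorFourier.norm_fourierSMulRight_le (innerSL ℝ) f ξ
    linarith
  have happ : ∀ h : ℂ, 𝓕 (fun ξ : ℂ => -(2 * Real.pi * Complex.I) * ((inner ℝ ξ h : ℝ) : ℂ) * f ξ) w
      = ((Real.pi / s * (Real.exp (-Real.pi ^ 2 * ‖w‖ ^ 2 / s) *
        ((-Real.pi ^ 2 / s) * (2 * inner ℝ w h))) : ℝ) : ℂ) := by
    intro h
    have h1 := congrArg (fun T : ℂ →L[ℝ] ℂ => T h) hu
    rw [Real.fourier_continuousLinearMap_apply hint] at h1
    convert! h1 using 2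
    · ext ξ
      rw [VectorFourier.fourierSMulRight_apply, Complex.real_smul, smul_eq_mul, ← mul_assoc]
      rfl
    · simp
      ring
  have hI : ∀ h : ℂ,
      Integrable (fun ξ : ℂ => -(2 * Real.pi * Complex.I) * ((inner ℝ ξ h : ℝ) : ℂ) * f ξ)
        volume := by
    intro h
    refine (hint.apply_continuousLinearMap h).congr (Eventually.of_forall fun ξ => ?_)
    beta_reduce
    rw [VectorFourier.fourierSMulRight_apply, Complex.real_smul, smul_eq_mul, ← mul_assoc]
    rfl
  -- `conj ξ = ⟪ξ, 1⟫ - i ⟪ξ, i⟫` reduces the first moment to two directional derivatives.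
  have hsplit : (fun ξ : ℂ => (starRingEnd ℂ) ξ * f ξ) =
      (Complex.I / (2 * Real.pi)) •
        ((fun ξ : ℂ => -(2 * Real.pi * Complex.I) * ((inner ℝ ξ 1 : ℝ) : ℂ) * f ξ) +
        (-Complex.I) •
          (fun ξ : ℂ => -(2 * Real.pi * Complex.I) * ((inner ℝ ξ Complex.I : ℝ) : ℂ) * f ξ)) := by
    ext ξ
    have hpi : (Real.pi : ℂ) ≠ 0 := by exact_mod_cast Real.pi_ne_zero
    have hc : (starRingEnd ℂ) ξ = (ξ.re : ℂ) - ξ.im * Complex.I := by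
      apply Complex.ext <;> simp
    rw [hc]
    simp only [Pi.smul_apply, Pi.add_apply, smul_eq_mul, Complex.inner]
    simp
    field_simp
    linear_combination (ξ.re - ξ.im * Complex.I) * f ξ * Complex.I_sq
  change 𝓕 (fun ξ : ℂ => (starRingEnd ℂ) ξ * f ξ) w = _
  have hlin : 𝓕 (fun ξ : ℂ => (starRingEnd ℂ) ξ * f ξ) w = (Complex.I / (2 * Real.pi)) *
      (𝓕 (fun ξ : ℂ => -(2 * Real.pi * Complex.I) * ((inner ℝ ξ 1 : ℝ) : ℂ) * f ξ) w +
      (-Complex.I) *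
        𝓕 (fun ξ : ℂ => -(2 * Real.pi * Complex.I) * ((inner ℝ ξ Complex.I : ℝ) : ℂ) * f ξ) w) := by
    rw [hsplit]
    change VectorFourier.fourierIntegral _ _ _ _ w = _
    rw [VectorFourier.fourierIntegral_const_smul, Pi.smul_apply,
      VectorFourier.fourierIntegral_add Real.continuous_fourierChar (by exact continuous_inner)
        (hI 1) ((hI Complex.I).smul _), Pi.add_apply, VectorFourier.fourierIntegral_const_smul,
      Pi.smul_apply]
    rfl
  rw [hlin, happ, happ]
  have hpi : (Real.pi : ℂ) ≠ 0 := by exact_mod_cast Real.pi_ne_zero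
  have hs0 : (s : ℂ) ≠ 0 := by exact_mod_cast hs.ne'
  have hc : (starRingEnd ℂ) w = (w.re : ℂ) - w.im * Complex.I := by
    apply Complex.ext <;> simp
  rw [hc]
  simp only [Complex.inner]
  simp
  field_simp
  ring

/-- Writing `gaussQuot` as a superposition of first moments of Gaussians removes the
singularity at the origin. -/
theorem gaussQuot_eq_intervalIntegral (a b : ℝ) (ξ : ℂ) :
    gaussQuot a b ξ = ∫ s in a..b, (starRingEnd ℂ) ξ * ((Real.exp (-s * ‖ξ‖ ^ 2) : ℝ) : ℂ) := by
  rcases eq_or_ne ξ 0 with rfl | hξ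
  · simp [gaussQuot]
  have hn : ‖ξ‖ ≠ 0 := norm_ne_zero_iff.2 hξ
  have hI : ∫ s in a..b, Real.exp (-s * ‖ξ‖ ^ 2) =
      (Real.exp (-a * ‖ξ‖ ^ 2) - Real.exp (-b * ‖ξ‖ ^ 2)) / ‖ξ‖ ^ 2 := by
    rw [intervalIntegral.integral_eq_sub_of_hasDerivAt
      (f := fun s => -Real.exp (-s * ‖ξ‖ ^ 2) / ‖ξ‖ ^ 2)]
    · ring
    · intro s _
      have : HasDerivAt (fun s : ℝ => -s * ‖ξ‖ ^ 2) (-1 * ‖ξ‖ ^ 2) s :=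
        (hasDerivAt_id s).neg.mul_const _
      convert! this.exp.neg.div_const (‖ξ‖ ^ 2) using 1
      field_simp
    · exact Continuous.intervalIntegrable (by fun_prop) _ _
  rw [intervalIntegral.integral_const_mul, intervalIntegral.integral_ofReal, hI, gaussQuot]
  have := Complex.conj_mul' ξ
  have hn' : (‖ξ‖ : ℂ) ≠ 0 := by exact_mod_cast hn
  generalize Real.exp (-a * ‖ξ‖ ^ 2) - Real.exp (-b * ‖ξ‖ ^ 2) = D
  push_cast
  field_simp
  linear_combination (-(D : ℂ)) * this

/-- The class of functions `gaussQuot` is invariant under the Fourier transform: this is the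
Fourier transform of `1 / ξ`, regularised by a difference of Gaussians. -/
theorem fourier_gaussQuot {a b : ℝ} (ha : 0 < a) (hab : a ≤ b) (w : ℂ) :
    𝓕 (gaussQuot a b) w = -Complex.I * gaussQuot (Real.pi ^ 2 / b) (Real.pi ^ 2 / a) w := by
  have hpos : ∀ s ∈ Set.uIcc a b, 0 < s := fun s hs => by
    rw [Set.uIcc_of_le hab] at hs; exact ha.trans_le hs.1
  have hfub : Integrable (Function.uncurry fun (s : ℝ) (ξ : ℂ) => Real.fourierChar (-inner ℝ ξ w) •
      ((starRingEnd ℂ) ξ * ((Real.exp (-s * ‖ξ‖ ^ 2) : ℝ) : ℂ)))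
      ((volume.restrict (Set.uIoc a b)).prod volume) := by
    have : IsFiniteMeasure (volume.restrict (Set.uIoc a b)) := by
      rw [Set.uIoc_of_le hab]; infer_instance
    have hdom : Integrable (fun q : ℝ × ℂ => (1 : ℝ) * (‖q.2‖ * Real.exp (-a * ‖q.2‖ ^ 2)))
        ((volume.restrict (Set.uIoc a b)).prod volume) :=
      Integrable.mul_prod (f := fun _ : ℝ => (1 : ℝ)) (integrable_const _)
        (integrable_norm_mul_exp ha)
    refine hdom.mono' ?_ ?_
    · have : Continuous (Function.uncurry fun (s : ℝ) (ξ : ℂ) => Real.fourierChar (-inner ℝ ξ w) •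
        ((starRingEnd ℂ) ξ * ((Real.exp (-s * ‖ξ‖ ^ 2) : ℝ) : ℂ))) := by
        have h1 := Real.continuous_fourierChar
        simp only [Circle.smul_def]
        fun_prop
      exact this.aestronglyMeasurable
    · have h1 : ∀ᵐ q : ℝ × ℂ ∂((volume.restrict (Set.uIoc a b)).prod volume), q.1 ∈ Set.uIoc a b :=
        Measure.quasiMeasurePreserving_fst.ae (ae_restrict_mem measurableSet_uIoc)
      filter_upwards [h1] with q hq
      rw [Set.uIoc_of_le hab] at hq
      have := hq.1.le
      simp only [Function.uncurry, Circle.norm_smul, norm_mul, RCLike.norm_conj, Complex.norm_real,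
        Real.norm_of_nonneg (Real.exp_pos _).le, one_mul]
      gcongr
  -- The substitution `s ↦ π² / s` carries the transformed superposition into one of the same form.
  have hI : ∫ s in a..b, Real.pi ^ 2 / s ^ 2 * Real.exp (-Real.pi ^ 2 * ‖w‖ ^ 2 / s) = 
      (∫ s in (Real.pi ^ 2 / b)..(Real.pi ^ 2 / a), Real.exp (-s * ‖w‖ ^ 2)) := by
    have hd : ∀ s ∈ Set.uIcc a b,
        HasDerivAt (fun s : ℝ => Real.pi ^ 2 / s) (-(Real.pi ^ 2 / s ^ 2)) s := fun s hs => by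
      have := (hasDerivAt_inv (hpos s hs).ne').const_mul (Real.pi ^ 2)
      simpa only [div_eq_mul_inv, mul_neg] using this
    have := intervalIntegral.integral_comp_mul_deriv (g := fun s => Real.exp (-s * ‖w‖ ^ 2)) hd
      (by
        refine ContinuousOn.neg (continuousOn_const.div (by fun_prop) fun s hs => ?_)
        exact pow_ne_zero _ (hpos s hs).ne') (by fun_prop)
    rw [intervalIntegral.integral_symm (Real.pi ^ 2 / a), ← this, ← intervalIntegral.integral_neg]
    refine intervalIntegral.integral_congr fun s _ => ?_
    simp only [Function.comp]
    rw [mul_neg, neg_neg, mul_comm]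
    congr 2; ring
  calc 𝓕 (gaussQuot a b) w = ∫ ξ : ℂ, ∫ s in a..b, Real.fourierChar (-inner ℝ ξ w) •
      ((starRingEnd ℂ) ξ * ((Real.exp (-s * ‖ξ‖ ^ 2) : ℝ) : ℂ)) := by
        rw [Real.fourier_eq]
        refine integral_congr_ae (Eventually.of_forall fun ξ => ?_)
        beta_reduce
        rw [gaussQuot_eq_intervalIntegral, Circle.smul_def, smul_eq_mul,
          ← intervalIntegral.integral_const_mul]
        rfl
    _ = ∫ s in a..b, ∫ ξ : ℂ, Real.fourierChar (-inner ℝ ξ w) •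
      ((starRingEnd ℂ) ξ * ((Real.exp (-s * ‖ξ‖ ^ 2) : ℝ) : ℂ)) :=
        (intervalIntegral_integral_swap hfub).symm
    _ = ∫ s in a..b, -Complex.I * (starRingEnd ℂ) w *
        ((Real.pi ^ 2 / s ^ 2 * Real.exp (-Real.pi ^ 2 * ‖w‖ ^ 2 / s) : ℝ) : ℂ) := by
        refine intervalIntegral.integral_congr fun s hs => ?_
        exact (Real.fourier_eq _ _).symm.trans (fourier_conj_mul_gaussian (hpos s hs) w)
    _ = _ := by
        rw [intervalIntegral.integral_const_mul, intervalIntegral.integral_ofReal, hI,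
          gaussQuot_eq_intervalIntegral, intervalIntegral.integral_const_mul,
          intervalIntegral.integral_ofReal, mul_assoc]

/-- The Fourier transform exchanges modulation and translation. -/
theorem fourier_modulate (g : ℂ → ℂ) (z w : ℂ) :
    𝓕 (fun ξ : ℂ => (Real.fourierChar (inner ℝ ξ z) : ℂ) * g ξ) w = 𝓕 g (w - z) := by
  rw [Real.fourier_eq, Real.fourier_eq]
  congr with ξ
  rw [inner_sub_right, neg_sub, sub_eq_neg_add, AddChar.map_add_eq_mul, mul_smul, Circle.smul_def,
    Circle.smul_def, Circle.smul_def]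
  simp only [smul_eq_mul]

/-! ### Convergence of the Cauchy integral at a point -/

theorem measurable_gaussian_div_norm (z : ℂ) (ρ : ℝ) :
    Measurable (fun w : ℂ => Real.exp (-(‖w - z‖ ^ 2 / ρ ^ 2)) / ‖w - z‖) := by
  fun_prop

/-- This is the potential estimate for the constant function `1`, whose maximal function is at
most `1`. -/
theorem integrable_gaussian_div_norm (z : ℂ) {ρ : ℝ} (hρ : 0 < ρ) :
    Integrable (fun w : ℂ => Real.exp (-(‖w - z‖ ^ 2 / ρ ^ 2)) / ‖w - z‖) volume := by
  refine ⟨(measurable_gaussian_div_norm z ρ).aestronglyMeasurable, ?_⟩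
  rw [hasFiniteIntegral_iff_ofReal (Eventually.of_forall fun w => by positivity)]
  have h1 := lintegral_gaussian_potential_le (h := fun _ => 1) aestronglyMeasurable_const z hρ
  have h2 : maximalFunction (fun _ => 1) z ≤ 1 := maximalFunction_le_of_norm_le_one (by simp) z
  simp only [enorm_one, one_mul] at h1
  exact (h1.trans (mul_le_mul_right h2 _)).trans_lt (by simp)

theorem integrable_comp_gaussian {z : ℂ} {R : ℝ} (hR : 0 < R) :
    Integrable (fun w : ℂ => Real.exp (-(‖w - z‖ ^ 2 / R ^ 2))) volume := by
  have h := (integrable_exp_neg_mul_sq_norm (a := (R ^ 2)⁻¹) (by positivity)).comp_sub_right z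
  refine h.congr (Eventually.of_forall fun w => ?_)
  beta_reduce
  congr 1; ring

theorem integral_comp_gaussian (z : ℂ) {R : ℝ} (hR : 0 < R) :
    ∫ w : ℂ, Real.exp (-(‖w - z‖ ^ 2 / R ^ 2)) = Real.pi * R ^ 2 := by
  have h := GaussianFourier.integral_rexp_neg_mul_sq_norm (V := ℂ) (b := (R ^ 2)⁻¹) (by positivity)
  rw [← integral_sub_right_eq_self _ z] at h
  simp only [Complex.finrank_real_complex] at h
  norm_num at h
  rw [← h]
  refine integral_congr_ae (Eventually.of_forall fun w => ?_)
  beta_reduce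
  congr 1; ring

section Pointwise
variable {f : ℂ → ℂ} {p : ℝ≥0∞} {z : ℂ}

theorem norm_lowPart_le_one (f : ℂ → ℂ) (w : ℂ) : ‖lowPart f w‖ ≤ 1 := by
  by_cases h : ‖f w‖ ≤ 1 <;> simp [lowPart, h]

theorem norm_highPart_le (f : ℂ → ℂ) (w : ℂ) : ‖highPart f w‖ ≤ ‖f w‖ :=
  norm_indicator_le_norm_self _ _

theorem norm_lowPart_le (f : ℂ → ℂ) (w : ℂ) : ‖lowPart f w‖ ≤ ‖f w‖ :=
  norm_indicator_le_norm_self _ _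

/-- Outside the unit disc around `z` the Cauchy kernel is bounded, inside it is comparable with
the kernel damped by a Gaussian. -/
theorem inv_norm_sub_le (z w : ℂ) :
    ‖w - z‖⁻¹ ≤ Real.exp 1 * (Real.exp (-(‖w - z‖ ^ 2 / 1 ^ 2)) / ‖w - z‖) + 1 := by
  rcases le_or_gt ‖w - z‖ 1 with h | h
  · have : 1 ≤ Real.exp 1 * Real.exp (-(‖w - z‖ ^ 2 / 1 ^ 2)) := by
      rw [← Real.exp_add]
      refine Real.one_le_exp ?_
      nlinarith [norm_nonneg (w - z)]
    calc ‖w - z‖⁻¹ = 1 * ‖w - z‖⁻¹ := (one_mul _).symm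
      _ ≤ Real.exp 1 * Real.exp (-(‖w - z‖ ^ 2 / 1 ^ 2)) * ‖w - z‖⁻¹ := by gcongr
      _ ≤ _ := by rw [mul_assoc, ← div_eq_mul_inv]; linarith
  · have h1 : ‖w - z‖⁻¹ ≤ 1 := inv_le_one_of_one_le₀ h.le
    have : 0 ≤ Real.exp 1 * (Real.exp (-(‖w - z‖ ^ 2 / 1 ^ 2)) / ‖w - z‖) := by positivity
    linarith

theorem integrable_highPart_div (h1 : 1 ≤ p) (h2 : p ≤ 2) (hf : MemLp f p volume)
    (h : Integrable (fun w => ‖highPart f w‖ *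
      (Real.exp (-(‖w - z‖ ^ 2 / 1 ^ 2)) / ‖w - z‖)) volume) :
    Integrable (fun w => highPart f w / (z - w)) volume := by
  have hH := integrable_highPart h1 h2 hf
  refine Integrable.mono' ((h.const_mul (Real.exp 1)).add hH.norm)
    (hH.1.mul (by fun_prop : AEStronglyMeasurable (fun w : ℂ => (z - w)⁻¹) volume))
    (Eventually.of_forall fun w => ?_)
  rw [norm_div, norm_sub_rev, div_eq_mul_inv, Pi.add_apply]
  grw [inv_norm_sub_le z w]
  exact (by ring : _ = _).le

theorem ae_integrable_highPart_div (h1 : 1 ≤ p) (h2 : p ≤ 2) (hf : MemLp f p volume) :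
    ∀ᵐ z : ℂ, Integrable (fun w => highPart f w / (z - w)) volume := by
  have hH := integrable_highPart h1 h2 hf
  have hG := integrable_gaussian_div_norm 0 one_pos
  filter_upwards [hH.norm.ae_convolution_exists (ContinuousLinearMap.mul ℝ ℝ) hG] with z hz
  refine integrable_highPart_div h1 h2 hf ?_
  refine hz.integrable.congr (Eventually.of_forall fun w => ?_)
  simp [norm_sub_rev]

theorem integrable_gaussian_potential (hf : AEStronglyMeasurable f volume)
    (hz : maximalFunction f z < ∞) {r : ℝ} (hr : 0 < r) :
    Integrable (fun w => ‖f w‖ * (Real.exp (-(‖w - z‖ ^ 2 / r ^ 2)) / ‖w - z‖)) volume ∧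
    ∫ w, ‖f w‖ * (Real.exp (-(‖w - z‖ ^ 2 / r ^ 2)) / ‖w - z‖) ≤
      8 * Real.pi ^ 2 * r * (maximalFunction f z).toReal := by
  have hl := lintegral_gaussian_potential_le hf z hr
  have hm : AEStronglyMeasurable
      (fun w => ‖f w‖ * (Real.exp (-(‖w - z‖ ^ 2 / r ^ 2)) / ‖w - z‖)) volume :=
    hf.norm.mul (measurable_gaussian_div_norm z r).aestronglyMeasurable
  have hnn : ∀ w, 0 ≤ ‖f w‖ * (Real.exp (-(‖w - z‖ ^ 2 / r ^ 2)) / ‖w - z‖) :=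
    fun w => by positivity
  have he : ∫⁻ w, ENNReal.ofReal (‖f w‖ * (Real.exp (-(‖w - z‖ ^ 2 / r ^ 2)) / ‖w - z‖)) =
      ∫⁻ y, ‖f y‖ₑ * ENNReal.ofReal (Real.exp (-(‖y - z‖ ^ 2 / r ^ 2)) / ‖y - z‖) := by
    congr with w
    rw [ENNReal.ofReal_mul (norm_nonneg _), ofReal_norm]
  rw [← he] at hl
  have htop : ENNReal.ofReal (8 * Real.pi ^ 2 * r) * maximalFunction f z < ∞ :=
    ENNReal.mul_lt_top ENNReal.ofReal_lt_top hz
  refine ⟨⟨hm, ?_⟩, ?_⟩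
  · rw [hasFiniteIntegral_iff_ofReal (Eventually.of_forall hnn)]
    exact hl.trans_lt htop
  · rw [integral_eq_lintegral_of_nonneg_ae (Eventually.of_forall hnn) hm]
    refine (ENNReal.toReal_mono htop.ne hl).trans_eq ?_
    rw [ENNReal.toReal_mul, ENNReal.toReal_ofReal (by positivity)]

/-- Finiteness of the maximal function at `z` makes the Cauchy kernel locally integrable against
`f` there. -/
theorem integrable_highPart_div_of_maximalFunction (h1 : 1 ≤ p) (h2 : p ≤ 2)
    (hf : MemLp f p volume) (hz : maximalFunction f z < ∞) :
    Integrable (fun w => highPart f w / (z - w)) volume := by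
  refine integrable_highPart_div h1 h2 hf ?_
  refine (integrable_gaussian_potential hf.1 hz one_pos).1.mono
    ((integrable_highPart h1 h2 hf).1.norm.mul
    (measurable_gaussian_div_norm z 1).aestronglyMeasurable) (Eventually.of_forall fun w => ?_)
  rw [norm_mul, norm_mul, norm_norm, norm_norm]
  gcongr
  exact norm_highPart_le f w

theorem integrableOn_inv_ball (z : ℂ) (R : ℝ) :
    IntegrableOn (fun w : ℂ => ‖w - z‖⁻¹) (ball 0 R) volume := by
  have : IsFiniteMeasure (volume.restrict (ball (0 : ℂ) R)) :=
    ⟨by rw [Measure.restrict_apply_univ]; exact measure_ball_lt_top⟩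
  refine Integrable.mono' (((integrable_gaussian_div_norm z one_pos).const_mul
    (Real.exp 1)).integrableOn.add (integrable_const (1 : ℝ))) (by fun_prop)
    (Eventually.of_forall fun w => ?_)
  rw [norm_inv, norm_norm]
  exact inv_norm_sub_le z w

theorem integrableOn_lowPart_div (h1 : 1 ≤ p) (h2 : p ≤ 2) (hf : MemLp f p volume) (R : ℝ) :
    IntegrableOn (fun w => lowPart f w / (z - w)) (ball 0 R) volume := by
  refine Integrable.mono' (integrableOn_inv_ball z R)
    ((memLp_lowPart h1 h2 hf).1.restrict.mul
    (by fun_prop : AEStronglyMeasurable (fun w : ℂ => (z - w)⁻¹) _))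
    (Eventually.of_forall fun w => ?_)
  rw [norm_div, norm_sub_rev, div_eq_mul_inv]
  exact mul_le_of_le_one_left (by positivity) (norm_lowPart_le_one f w)

theorem div_eq_high_add_low (f : ℂ → ℂ) (z w : ℂ) :
    f w / (z - w) = highPart f w / (z - w) + lowPart f w / (z - w) := by
  rw [← add_div, highPart_add_lowPart]

theorem integrableOn_div (h1 : 1 ≤ p) (h2 : p ≤ 2) (hf : MemLp f p volume)
    (hz : Integrable (fun w => highPart f w / (z - w)) volume) (R : ℝ) :
    IntegrableOn (fun w => f w / (z - w)) (ball 0 R) volume := by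
  simp_rw [div_eq_high_add_low f]
  exact hz.integrableOn.add (integrableOn_lowPart_div h1 h2 hf R)

/-- The Cauchy integral with a Gaussian cutoff at scale `R` around the pole. -/
def dampedCauchy (f : ℂ → ℂ) (R : ℝ) (z : ℂ) : ℂ :=
  ∫ w, f w / (z - w) * ((Real.exp (-(‖w - z‖ ^ 2 / R ^ 2)) : ℝ) : ℂ)

theorem integrable_lowPart_div_mul (h1 : 1 ≤ p) (h2 : p ≤ 2) (hf : MemLp f p volume)
    {R : ℝ} (hR : 0 < R) :
    Integrable (fun w => lowPart f w / (z - w) *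
      ((Real.exp (-(‖w - z‖ ^ 2 / R ^ 2)) : ℝ) : ℂ)) volume := by
  refine Integrable.mono' (integrable_gaussian_div_norm z hR)
    (((memLp_lowPart h1 h2 hf).1.mul
    (by fun_prop : AEStronglyMeasurable (fun w : ℂ => (z - w)⁻¹) _)).mul (by fun_prop))
    (Eventually.of_forall fun w => ?_)
  rw [norm_mul, norm_div, norm_sub_rev z w, Complex.norm_real,
    Real.norm_of_nonneg (Real.exp_pos _).le, div_mul_eq_mul_div]
  gcongr
  exact mul_le_of_le_one_left (Real.exp_pos _).le (norm_lowPart_le_one f w)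

theorem norm_exp_neg_le_one (x R : ℝ) : ‖((Real.exp (-(x ^ 2 / R ^ 2)) : ℝ) : ℂ)‖ ≤ 1 := by
  rw [Complex.norm_real, Real.norm_of_nonneg (Real.exp_pos _).le]
  exact Real.exp_le_one_iff.2 (by rw [neg_nonpos]; positivity)

theorem integrable_highPart_div_mul
    (hz : Integrable (fun w => highPart f w / (z - w)) volume) (R : ℝ) :
    Integrable (fun w => highPart f w / (z - w) *
      ((Real.exp (-(‖w - z‖ ^ 2 / R ^ 2)) : ℝ) : ℂ)) volume :=
  hz.mul_bdd (c := 1) (by fun_prop) (Eventually.of_forall fun w => norm_exp_neg_le_one _ _)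

theorem integrable_div_mul (h1 : 1 ≤ p) (h2 : p ≤ 2) (hf : MemLp f p volume)
    (hz : Integrable (fun w => highPart f w / (z - w)) volume) {R : ℝ} (hR : 0 < R) :
    Integrable (fun w => f w / (z - w) *
      ((Real.exp (-(‖w - z‖ ^ 2 / R ^ 2)) : ℝ) : ℂ)) volume := by
  simp_rw [div_eq_high_add_low f, add_mul]
  exact (integrable_highPart_div_mul hz R).add (integrable_lowPart_div_mul h1 h2 hf hR)

theorem norm_dampedCauchy_le (hf : AEStronglyMeasurable f volume)
    (hz : maximalFunction f z < ∞) {r : ℝ} (hr : 0 < r) :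
    ‖dampedCauchy f r z‖ ≤ 8 * Real.pi ^ 2 * r * (maximalFunction f z).toReal := by
  refine le_trans ?_ (integrable_gaussian_potential hf hz hr).2
  refine (norm_integral_le_integral_norm _).trans_eq ?_
  congr with w
  rw [norm_mul, norm_div, norm_sub_rev z w, Complex.norm_real,
    Real.norm_of_nonneg (Real.exp_pos _).le]
  ring

/-! ### Comparison of the sharp and the Gaussian cutoff -/

/-- The difference of the cutoff to the disc `|w| < R` and the Gaussian cutoff around `z`. -/
def cutoffDiff (R : ℝ) (z w : ℂ) : ℝ :=
  (ball (0 : ℂ) R).indicator 1 w - Real.exp (-(‖w - z‖ ^ 2 / R ^ 2))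

theorem measurable_cutoffDiff (R : ℝ) (z : ℂ) : Measurable (cutoffDiff R z) := by
  refine Measurable.sub ?_ (by fun_prop)
  exact measurable_one.indicator measurableSet_ball

theorem abs_cutoffDiff_le_one (R : ℝ) (z w : ℂ) : |cutoffDiff R z w| ≤ 1 := by
  have h1 := Real.exp_pos (-(‖w - z‖ ^ 2 / R ^ 2))
  have h2 : Real.exp (-(‖w - z‖ ^ 2 / R ^ 2)) ≤ 1 :=
    Real.exp_le_one_iff.2 (by rw [neg_nonpos]; positivity)
  rw [abs_le, cutoffDiff]
  by_cases h : w ∈ ball (0 : ℂ) R <;> simp only [h, Set.indicator_of_mem,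
    Set.indicator_of_notMem, not_false_eq_true, Pi.one_apply] <;> constructor <;> linarith

theorem tendsto_cutoffDiff (z w : ℂ) : Tendsto (fun R => cutoffDiff R z w) atTop (𝓝 0) := by
  have h1 : Tendsto (fun R : ℝ => 1 - Real.exp (-(‖w - z‖ ^ 2 / R ^ 2))) atTop (𝓝 0) := by
    have : Tendsto (fun R : ℝ => ‖w - z‖ ^ 2 / R ^ 2) atTop (𝓝 0) :=
      tendsto_const_nhds.div_atTop (tendsto_pow_atTop two_ne_zero)
    have h2 := (Real.continuous_exp.tendsto _).comp this.neg
    simpa using h2.const_sub 1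
  refine h1.congr' ?_
  filter_upwards [eventually_gt_atTop ‖w‖] with R hR
  simp [cutoffDiff, hR]

/-- Once `R ≥ 2|z|`, the kernel of the difference of the two cutoffs is dominated by an
`L²`-normalised Gaussian of width `R`. -/
theorem abs_cutoffDiff_div_le {R : ℝ} (hR : 0 < R) (hz : 2 * ‖z‖ ≤ R) (w : ℂ) :
    |cutoffDiff R z w| / ‖w - z‖ ≤
      2 * Real.exp (9 / 4) / R * Real.exp (-(‖w - z‖ ^ 2 / R ^ 2)) := by
  have hE := Real.exp_pos (-(‖w - z‖ ^ 2 / R ^ 2))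
  rcases (norm_nonneg (w - z)).eq_or_lt with h0 | h0
  · rw [← h0, div_zero]; positivity
  rw [div_le_iff₀ h0]
  by_cases h : ‖w‖ < R
  -- In the disc, `|w - z| ≤ 3R/2`; hence the constant `exp (9/4)`.
  · have hc : |cutoffDiff R z w| ≤ ‖w - z‖ ^ 2 / R ^ 2 := by
      have hcd : cutoffDiff R z w = 1 - Real.exp (-(‖w - z‖ ^ 2 / R ^ 2)) := by
        simp [cutoffDiff, h]
      have h3 := Real.add_one_le_exp (-(‖w - z‖ ^ 2 / R ^ 2))
      have h4 : Real.exp (-(‖w - z‖ ^ 2 / R ^ 2)) ≤ 1 :=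
        Real.exp_le_one_iff.2 (by rw [neg_nonpos]; positivity)
      rw [hcd, abs_of_nonneg (by linarith)]
      linarith
    have hd : ‖w - z‖ ≤ 3 / 2 * R := (norm_sub_le w z).trans (by linarith)
    have h5 : 1 ≤ Real.exp (9 / 4) * Real.exp (-(‖w - z‖ ^ 2 / R ^ 2)) := by
      rw [← Real.exp_add]
      refine Real.one_le_exp ?_
      have : ‖w - z‖ ^ 2 / R ^ 2 ≤ 9 / 4 := by
        rw [div_le_iff₀ (by positivity)]; nlinarith
      linarith
    calc |cutoffDiff R z w| ≤ ‖w - z‖ ^ 2 / R ^ 2 := hc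
      _ ≤ 2 / R * ‖w - z‖ := by
        rw [div_le_iff₀ (by positivity)]
        have : 2 / R * ‖w - z‖ * R ^ 2 = 2 * R * ‖w - z‖ := by field_simp
        rw [this]; nlinarith
      _ ≤ 2 / R * ‖w - z‖ * (Real.exp (9 / 4) * Real.exp (-(‖w - z‖ ^ 2 / R ^ 2))) :=
        le_mul_of_one_le_right (by positivity) h5
      _ = _ := by ring
  · have hcd : |cutoffDiff R z w| = Real.exp (-(‖w - z‖ ^ 2 / R ^ 2)) := by
      simp [cutoffDiff, h]
    have hd : R / 2 ≤ ‖w - z‖ := by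
      have := norm_sub_norm_le w z
      linarith
    have h5 : 1 ≤ Real.exp (9 / 4) := Real.one_le_exp (by norm_num)
    have h6 : 1 ≤ 2 / R * ‖w - z‖ := by
      rw [div_mul_eq_mul_div, le_div_iff₀ hR]; linarith
    rw [hcd]
    calc Real.exp (-(‖w - z‖ ^ 2 / R ^ 2))
        ≤ (Real.exp (9 / 4) * (2 / R * ‖w - z‖)) * Real.exp (-(‖w - z‖ ^ 2 / R ^ 2)) :=
          le_mul_of_one_le_left hE.le (one_le_mul_of_one_le_of_one_le h5 h6)
      _ = _ := by ring

end Pointwise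

section Limit
variable {f : ℂ → ℂ} {p : ℝ≥0∞} {z : ℂ}

/-- A square integrable function tested against an `L²`-normalised Gaussian of width `R` tends to
zero as `R → ∞`. -/
theorem tendsto_integral_mul_gaussian {u : ℂ → ℂ} (hu : MemLp u 2 volume)
    (hu1 : ∀ w, ‖u w‖ ≤ 1) (z : ℂ) :
    Tendsto (fun R : ℝ => R⁻¹ * ∫ w, ‖u w‖ * Real.exp (-(‖w - z‖ ^ 2 / R ^ 2))) atTop (𝓝 0) := by
  have hsq : Integrable (fun w => ‖u w‖ ^ 2) volume := hu.integrable_norm_pow two_ne_zero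
  have htail : Tendsto (fun A : ℝ => ∫ w in (ball (0 : ℂ) A)ᶜ, ‖u w‖ ^ 2) atTop (𝓝 0) := by
    have h := (aecover_ball (μ := (volume : Measure ℂ)) (x := 0)
      (tendsto_id (α := ℝ) (x := atTop))).integral_tendsto_of_countably_generated hsq
    have h' := h.const_sub (∫ w, ‖u w‖ ^ 2)
    rw [sub_self] at h'
    refine h'.congr fun A => ?_
    rw [setIntegral_compl measurableSet_ball hsq, id]
  refine Metric.tendsto_atTop.2 fun ε hε => ?_
  set δ := ε / 4
  have hδ : 0 < δ := by positivity
  obtain ⟨A, hA0, hA⟩ : ∃ A : ℝ, 0 < A ∧ ∫ w in (ball (0 : ℂ) A)ᶜ, ‖u w‖ ^ 2 < δ ^ 2 :=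
    ((eventually_gt_atTop 0).and (htail.eventually_lt_const (by positivity))).exists
  refine ⟨Real.pi * A ^ 2 / δ, fun R hR => ?_⟩
  have hR0 : 0 < R := lt_of_lt_of_le (by positivity) hR
  have hint := integrable_comp_gaussian (z := z) hR0
  -- In the disc of radius `A` the integrand is at most `1 / R`; outside it, the inequality of the
  -- means with weight `δ` splits the product into the tail of `|u|²` and a squared Gaussian.
  have hpt : ∀ w, R⁻¹ * (‖u w‖ * Real.exp (-(‖w - z‖ ^ 2 / R ^ 2))) ≤
      (2 * δ)⁻¹ * (ball (0 : ℂ) A)ᶜ.indicator (fun w => ‖u w‖ ^ 2) w +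
      δ / 2 * (R ^ 2)⁻¹ * Real.exp (-(‖w - z‖ ^ 2 / R ^ 2)) +
      R⁻¹ * (ball (0 : ℂ) A).indicator 1 w := by
    intro w
    have hE := Real.exp_pos (-(‖w - z‖ ^ 2 / R ^ 2))
    have hE1 : Real.exp (-(‖w - z‖ ^ 2 / R ^ 2)) ≤ 1 :=
      Real.exp_le_one_iff.2 (by rw [neg_nonpos]; positivity)
    set e := Real.exp (-(‖w - z‖ ^ 2 / R ^ 2))
    by_cases h : w ∈ ball (0 : ℂ) A
    · have : ‖u w‖ * e ≤ 1 := mul_le_one₀ (hu1 w) hE.le hE1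
      have h2 : R⁻¹ * (‖u w‖ * e) ≤ R⁻¹ * 1 := by gcongr
      have h3 : 0 ≤ δ / 2 * (R ^ 2)⁻¹ * e := by positivity
      simp [h] at h2 h3 ⊢
      linarith
    · have h2 : R⁻¹ * (‖u w‖ * e) ≤ (2 * δ)⁻¹ * ‖u w‖ ^ 2 + δ / 2 * (R ^ 2)⁻¹ * e ^ 2 := by
        have : (2 * δ)⁻¹ * ‖u w‖ ^ 2 + δ / 2 * (R ^ 2)⁻¹ * e ^ 2 - R⁻¹ * (‖u w‖ * e) =
            (2 * δ)⁻¹ * (‖u w‖ - δ * R⁻¹ * e) ^ 2 := by field_simp; ring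
        have h0 : 0 ≤ (2 * δ)⁻¹ * (‖u w‖ - δ * R⁻¹ * e) ^ 2 := by positivity
        linarith
      have h3 : δ / 2 * (R ^ 2)⁻¹ * e ^ 2 ≤ δ / 2 * (R ^ 2)⁻¹ * e := by
        gcongr; nlinarith
      rw [Set.indicator_of_mem (by simpa using h), Set.indicator_of_notMem h]
      linarith
  have hi1 : Integrable ((ball (0 : ℂ) A)ᶜ.indicator (fun w => ‖u w‖ ^ 2)) volume :=
    hsq.indicator measurableSet_ball.compl
  have hi2 : Integrable ((ball (0 : ℂ) A).indicator (1 : ℂ → ℝ)) volume :=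
    (integrable_indicator_iff measurableSet_ball).2
      (integrableOn_const (by exact measure_ball_lt_top.ne))
  have hnn : 0 ≤ R⁻¹ * ∫ w, ‖u w‖ * Real.exp (-(‖w - z‖ ^ 2 / R ^ 2)) := by positivity
  rw [Real.dist_eq, sub_zero, abs_of_nonneg hnn, ← integral_const_mul]
  have hle := integral_mono_of_nonneg (μ := volume)
    (Eventually.of_forall fun w => by positivity)
    (((hi1.const_mul (2 * δ)⁻¹).add (hint.const_mul (δ / 2 * (R ^ 2)⁻¹))).add (hi2.const_mul R⁻¹))
    (Eventually.of_forall hpt)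
  refine hle.trans_lt ?_
  rw [integral_add' ((hi1.const_mul (2 * δ)⁻¹).add (hint.const_mul (δ / 2 * (R ^ 2)⁻¹)))
    (hi2.const_mul R⁻¹), integral_add' (hi1.const_mul (2 * δ)⁻¹)
    (hint.const_mul (δ / 2 * (R ^ 2)⁻¹)), integral_const_mul, integral_const_mul,
    integral_const_mul, integral_comp_gaussian z hR0, integral_indicator measurableSet_ball.compl,
    integral_indicator_one measurableSet_ball]
  have hvol : volume.real (ball (0 : ℂ) A) = Real.pi * A ^ 2 := by
    rw [measureReal_def, Complex.volume_ball, ENNReal.toReal_mul, ENNReal.toReal_pow,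
      ENNReal.toReal_ofReal hA0.le]
    simp [mul_comm]
  rw [hvol]
  have t1 : (2 * δ)⁻¹ * ∫ w in (ball (0 : ℂ) A)ᶜ, ‖u w‖ ^ 2 ≤ δ / 2 := by
    rw [inv_mul_le_iff₀ (by positivity)]
    nlinarith
  have t2 : δ / 2 * (R ^ 2)⁻¹ * (Real.pi * R ^ 2) ≤ 2 * δ := by
    have : δ / 2 * (R ^ 2)⁻¹ * (Real.pi * R ^ 2) = δ / 2 * Real.pi := by field_simp
    rw [this]
    nlinarith [Real.pi_le_four]
  have t3 : R⁻¹ * (Real.pi * A ^ 2) ≤ δ := by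
    rw [inv_mul_le_iff₀ hR0]
    rwa [ge_iff_le, div_le_iff₀ hδ] at hR
  have : ε = 4 * δ := by simp [δ]; ring
  linarith

/-- The sharp cutoff and the Gaussian cutoff give the same limit. -/
theorem tendsto_truncated_sub_damped (h1 : 1 ≤ p) (h2 : p ≤ 2) (hf : MemLp f p volume)
    (hz : Integrable (fun w => highPart f w / (z - w)) volume) :
    Tendsto (fun R : ℝ => (∫ w in ball (0 : ℂ) R, f w / (z - w)) - dampedCauchy f R z)
      atTop (𝓝 0) := by
  have hH := integrable_highPart h1 h2 hf
  have hL := memLp_lowPart h1 h2 hf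
  have hmc : ∀ R, Measurable (fun w => ((cutoffDiff R z w : ℝ) : ℂ)) :=
    fun R => Complex.measurable_ofReal.comp (measurable_cutoffDiff R z)
  have hhigh : Tendsto (fun R : ℝ => ∫ w, highPart f w / (z - w) * (cutoffDiff R z w : ℂ))
      atTop (𝓝 0) := by
    rw [← integral_zero ℂ ℂ]
    refine tendsto_integral_filter_of_dominated_convergence
      (fun w => ‖highPart f w / (z - w)‖) ?_ ?_ hz.norm ?_
    · exact Eventually.of_forall fun R => hz.1.mul (hmc R).aestronglyMeasurable
    · refine Eventually.of_forall fun R => Eventually.of_forall fun w => ?_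
      rw [norm_mul, Complex.norm_real]
      exact mul_le_of_le_one_right (norm_nonneg _) (abs_cutoffDiff_le_one R z w)
    · refine Eventually.of_forall fun w => ?_
      have := ((Complex.continuous_ofReal.tendsto 0).comp (tendsto_cutoffDiff z w)).const_mul
        (highPart f w / (z - w))
      simpa using this
  have hlow : Tendsto (fun R : ℝ => ∫ w, lowPart f w / (z - w) * (cutoffDiff R z w : ℂ))
      atTop (𝓝 0) := by
    have hlim := (tendsto_integral_mul_gaussian hL (norm_lowPart_le_one f) z).const_mul
      (2 * Real.exp (9 / 4))
    rw [mul_zero] at hlim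
    refine squeeze_zero_norm' ?_ hlim
    filter_upwards [eventually_gt_atTop 0, eventually_ge_atTop (2 * ‖z‖)] with R hR hzR
    rw [← mul_assoc, ← integral_const_mul]
    refine norm_integral_le_of_norm_le ?_ (Eventually.of_forall fun w => ?_)
    · have := (integrable_comp_gaussian (z := z) hR).bdd_mul (c := 1) hL.1.norm
        (Eventually.of_forall fun w => by simpa using norm_lowPart_le_one f w)
      exact this.const_mul _
    · have := abs_cutoffDiff_div_le hR hzR w
      rw [norm_mul, Complex.norm_real, norm_div, norm_sub_rev, Real.norm_eq_abs]
      calc ‖lowPart f w‖ / ‖w - z‖ * |cutoffDiff R z w|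
          = ‖lowPart f w‖ * (|cutoffDiff R z w| / ‖w - z‖) := by ring
        _ ≤ ‖lowPart f w‖ * (2 * Real.exp (9 / 4) / R *
            Real.exp (-(‖w - z‖ ^ 2 / R ^ 2))) := by gcongr
        _ = _ := by ring
  have hsum := hhigh.add hlow
  rw [add_zero] at hsum
  refine hsum.congr' ?_
  filter_upwards [eventually_gt_atTop 0] with R hR
  have key : ∀ (g : ℂ → ℂ), IntegrableOn (fun w => g w / (z - w)) (ball 0 R) volume →
      Integrable (fun w => g w / (z - w) *
        ((Real.exp (-(‖w - z‖ ^ 2 / R ^ 2)) : ℝ) : ℂ)) volume →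
      Integrable (fun w => g w / (z - w) * (cutoffDiff R z w : ℂ)) volume ∧
      ∫ w, g w / (z - w) * (cutoffDiff R z w : ℂ) =
        (∫ w in ball (0 : ℂ) R, g w / (z - w)) - dampedCauchy g R z := by
    intro g hg1 hg2
    have hi := hg1.integrable_indicator measurableSet_ball
    have he : (fun w => g w / (z - w) * (cutoffDiff R z w : ℂ)) = fun w =>
        (ball (0 : ℂ) R).indicator (fun w => g w / (z - w)) w - g w / (z - w) *
        ((Real.exp (-(‖w - z‖ ^ 2 / R ^ 2)) : ℝ) : ℂ) := by
      ext w
      by_cases h : w ∈ ball (0 : ℂ) R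
      · rw [cutoffDiff, Set.indicator_of_mem h, Set.indicator_of_mem h, Complex.ofReal_sub,
          mul_sub, Pi.one_apply, Complex.ofReal_one, mul_one]
      · rw [cutoffDiff, Set.indicator_of_notMem h, Set.indicator_of_notMem h, Complex.ofReal_sub,
          mul_sub, Complex.ofReal_zero, mul_zero]
    rw [he]
    exact ⟨hi.sub hg2, by rw [integral_sub hi hg2, integral_indicator measurableSet_ball]; rfl⟩
  obtain ⟨k1, -⟩ := key _ hz.integrableOn (integrable_highPart_div_mul hz R)
  obtain ⟨k2, -⟩ := key _ (integrableOn_lowPart_div h1 h2 hf R)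
    (integrable_lowPart_div_mul h1 h2 hf hR)
  obtain ⟨-, k3⟩ := key _ (integrableOn_div h1 h2 hf hz R) (integrable_div_mul h1 h2 hf hz hR)
  rw [← k3, ← integral_add k1 k2]
  congr with w
  rw [div_eq_high_add_low f, add_mul]

/-! ### The Cauchy integral on the Fourier side -/

/-- The difference of two Gaussian cutoffs, computed from the Fourier transform of `f` by the
multiplication formula applied to a modulated `gaussQuot`. -/
theorem damped_sub_damped (h1 : 1 ≤ p) (h2 : p ≤ 2) (hf : MemLp f p volume)
    (hz : Integrable (fun w => highPart f w / (z - w)) volume) {r R : ℝ} (hr : 0 < r)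
    (hrR : r ≤ R) :
    dampedCauchy f R z - dampedCauchy f r z = -Complex.I *
      ∫ ξ : ℂ, fourierLp h1 h2 hf ((2 * Real.pi) • ξ) * ((Real.fourierChar (inner ℝ ξ z) : ℂ) *
        gaussQuot (Real.pi ^ 2 * r ^ 2) (Real.pi ^ 2 * R ^ 2) ξ) := by
  have hR := hr.trans_le hrR
  set g : ℂ → ℂ := fun ξ => (Real.fourierChar (inner ℝ ξ z) : ℂ) *
        gaussQuot (Real.pi ^ 2 * r ^ 2) (Real.pi ^ 2 * R ^ 2) ξ
  have ha : 0 < Real.pi ^ 2 * r ^ 2 := by positivity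
  have hab : Real.pi ^ 2 * r ^ 2 ≤ Real.pi ^ 2 * R ^ 2 := by gcongr
  have hchar : Continuous fun ξ : ℂ => (Real.fourierChar (inner ℝ ξ z) : ℂ) := by
    have := Real.continuous_fourierChar
    fun_prop
  have hg0 := integrable_gaussQuot ha hab
  have hgm : AEStronglyMeasurable g volume := hchar.aestronglyMeasurable.mul hg0.1
  have hgn : ∀ᵐ ξ, ‖g ξ‖ ≤ ‖gaussQuot (Real.pi ^ 2 * r ^ 2) (Real.pi ^ 2 * R ^ 2) ξ‖ :=
    Eventually.of_forall fun ξ => by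
      rw [norm_mul, Circle.norm_coe, one_mul]
  have hg1 : Integrable g volume := hg0.mono hgm hgn
  have hg2 : MemLp g 2 volume := (memLp_two_gaussQuot ha hab).mono hgm hgn
  have hFg : 𝓕 g = fun w => Complex.I * gaussQuot (R ^ 2)⁻¹ (r ^ 2)⁻¹ (z - w) := by
    ext w
    rw [fourier_modulate, fourier_gaussQuot ha hab]
    have e1 : Real.pi ^ 2 / (Real.pi ^ 2 * R ^ 2) = (R ^ 2)⁻¹ := by field_simp
    have e2 : Real.pi ^ 2 / (Real.pi ^ 2 * r ^ 2) = (r ^ 2)⁻¹ := by field_simp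
    rw [e1, e2, gaussQuot, gaussQuot, norm_sub_rev, ← neg_sub z w, div_neg]
    ring
  have hab' : (R ^ 2)⁻¹ ≤ (r ^ 2)⁻¹ := by gcongr
  have hg3 : MemLp (𝓕 g) 2 volume := by
    rw [hFg]
    refine MemLp.const_mul ?_ _
    exact (memLp_two_gaussQuot (by positivity) hab').comp_measurePreserving
      (Measure.measurePreserving_sub_left volume z)
  rw [integral_fourierLp_mul_eq h1 h2 hf hg1 hg2 hg3, ← integral_const_mul, dampedCauchy,
    dampedCauchy, ← integral_sub (integrable_div_mul h1 h2 hf hz hR)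
    (integrable_div_mul h1 h2 hf hz hr)]
  congr with w
  have e : ∀ s : ℝ, -(‖w - z‖ ^ 2 / s ^ 2) = -(s ^ 2)⁻¹ * ‖z - w‖ ^ 2 := fun s => by
    rw [norm_sub_rev]; ring
  rw [hFg]
  beta_reduce
  rw [e, e, gaussQuot, Complex.ofReal_sub]
  linear_combination (f w / (z - w) *
    (((Real.exp (-(R ^ 2)⁻¹ * ‖z - w‖ ^ 2) : ℝ) : ℂ) -
      ((Real.exp (-(r ^ 2)⁻¹ * ‖z - w‖ ^ 2) : ℝ) : ℂ))) * Complex.I_sq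

/-- On the Fourier side the Cauchy kernel with its singularity smoothed at scale `r` is
dominated by a Gaussian potential, hence by the maximal function at the origin. -/
theorem integrable_fourier_majorant (h1 : 1 ≤ p) (h2 : p ≤ 2) (hf : MemLp f p volume)
    (hN : maximalFunction (fourierLp h1 h2 hf) 0 < ∞) {r : ℝ} (hr : 0 < r) :
    Integrable (fun ξ : ℂ => ‖fourierLp h1 h2 hf ((2 * Real.pi) • ξ)‖ *
      (Real.exp (-(Real.pi ^ 2 * r ^ 2) * ‖ξ‖ ^ 2) / ‖ξ‖)) volume ∧
    ∫ ξ : ℂ, ‖fourierLp h1 h2 hf ((2 * Real.pi) • ξ)‖ *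
      (Real.exp (-(Real.pi ^ 2 * r ^ 2) * ‖ξ‖ ^ 2) / ‖ξ‖) ≤
        8 * Real.pi * (maximalFunction (fourierLp h1 h2 hf) 0).toReal / r := by
  obtain ⟨hi, hb⟩ := integrable_gaussian_potential (aestronglyMeasurable_fourierLp h1 h2 hf) hN
    (show 0 < 2 / r by positivity)
  set Φ : ℂ → ℝ := fun w => ‖fourierLp h1 h2 hf w‖ *
    (Real.exp (-(‖w - 0‖ ^ 2 / (2 / r) ^ 2)) / ‖w - 0‖)
  have he : (fun ξ : ℂ => ‖fourierLp h1 h2 hf ((2 * Real.pi) • ξ)‖ *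
      (Real.exp (-(Real.pi ^ 2 * r ^ 2) * ‖ξ‖ ^ 2) / ‖ξ‖)) =
      fun ξ => 2 * Real.pi * Φ ((2 * Real.pi) • ξ) := by
    ext ξ
    have hn : ‖(2 * Real.pi) • ξ‖ = 2 * Real.pi * ‖ξ‖ := by
      rw [norm_smul, Real.norm_of_nonneg (by positivity)]
    simp only [Φ, sub_zero, hn]
    have : -((2 * Real.pi * ‖ξ‖) ^ 2 / (2 / r) ^ 2) = -(Real.pi ^ 2 * r ^ 2) * ‖ξ‖ ^ 2 := by
      field_simp
    rw [this]
    rcases (norm_nonneg ξ).eq_or_lt with h | h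
    · simp [← h]
    · field_simp
  rw [he]
  have h2pi : (2 * Real.pi : ℝ) ≠ 0 := by positivity
  refine ⟨(hi.comp_smul h2pi).const_mul _, ?_⟩
  rw [integral_const_mul, Measure.integral_comp_smul, Complex.finrank_real_complex,
    abs_of_nonneg (by positivity), smul_eq_mul]
  calc 2 * Real.pi * (((2 * Real.pi) ^ 2)⁻¹ * ∫ w, Φ w)
      ≤ 2 * Real.pi * (((2 * Real.pi) ^ 2)⁻¹ * (8 * Real.pi ^ 2 * (2 / r) *
        (maximalFunction (fourierLp h1 h2 hf) 0).toReal)) := by gcongr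
    _ = _ := by field_simp

/-- If the maximal function of the Fourier transform is finite at the origin, the damped Cauchy
integrals converge as the damping is removed, at a rate controlled by that maximal function. -/
theorem exists_tendsto_dampedCauchy (h1 : 1 ≤ p) (h2 : p ≤ 2) (hf : MemLp f p volume)
    (hN : maximalFunction (fourierLp h1 h2 hf) 0 < ∞)
    (hz : Integrable (fun w => highPart f w / (z - w)) volume) :
    ∃ G : ℂ, Tendsto (fun R : ℝ => dampedCauchy f R z) atTop (𝓝 G) ∧
      ∀ r : ℝ, 0 < r → ‖G‖ ≤ ‖dampedCauchy f r z‖ +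
        8 * Real.pi * (maximalFunction (fourierLp h1 h2 hf) 0).toReal / r := by
  have hbound : ∀ r R : ℝ, 0 < r → r ≤ R → ∀ ξ : ℂ,
      ‖fourierLp h1 h2 hf ((2 * Real.pi) • ξ) * ((Real.fourierChar (inner ℝ ξ z) : ℂ) *
        gaussQuot (Real.pi ^ 2 * r ^ 2) (Real.pi ^ 2 * R ^ 2) ξ)‖ ≤
      ‖fourierLp h1 h2 hf ((2 * Real.pi) • ξ)‖ *
      (Real.exp (-(Real.pi ^ 2 * r ^ 2) * ‖ξ‖ ^ 2) / ‖ξ‖) := by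
    intro r R hr hrR ξ
    rw [norm_mul, norm_mul, Circle.norm_coe, one_mul]
    gcongr
    exact norm_gaussQuot_le (by gcongr) ξ
  have hchar : Continuous fun ξ : ℂ => (Real.fourierChar (inner ℝ ξ z) : ℂ) := by
    have := Real.continuous_fourierChar
    fun_prop
  have hq := quasiMeasurePreserving_smul (c := 2 * Real.pi) (by positivity)
  have hFm := (aestronglyMeasurable_fourierLp h1 h2 hf).comp_quasiMeasurePreserving hq
  have hlim : ∃ L : ℂ, Tendsto (fun R : ℝ =>
      ∫ ξ : ℂ, fourierLp h1 h2 hf ((2 * Real.pi) • ξ) * ((Real.fourierChar (inner ℝ ξ z) : ℂ) *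
        gaussQuot (Real.pi ^ 2 * 1 ^ 2) (Real.pi ^ 2 * R ^ 2) ξ)) atTop (𝓝 L) := by
    refine ⟨∫ ξ : ℂ, fourierLp h1 h2 hf ((2 * Real.pi) • ξ) *
      ((Real.fourierChar (inner ℝ ξ z) : ℂ) *
      (((Real.exp (-(Real.pi ^ 2 * 1 ^ 2) * ‖ξ‖ ^ 2) - 0 : ℝ) : ℂ) / ξ)),
      tendsto_integral_filter_of_dominated_convergence _ ?_ ?_
      (integrable_fourier_majorant h1 h2 hf hN one_pos).1 ?_⟩
    · exact Eventually.of_forall fun R => hFm.mul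
        (hchar.aestronglyMeasurable.mul (measurable_gaussQuot _ _).aestronglyMeasurable)
    · filter_upwards [eventually_ge_atTop 1] with R hR
      exact Eventually.of_forall fun ξ => hbound 1 R one_pos hR ξ
    · refine Eventually.of_forall fun ξ => ?_
      refine Tendsto.const_mul _ (Tendsto.const_mul _ ?_)
      rcases eq_or_ne ξ 0 with rfl | hξ
      · simp [gaussQuot]
      refine Tendsto.div_const ?_ _
      refine (Complex.continuous_ofReal.tendsto _).comp (Tendsto.const_sub _ ?_)
      have hc : 0 < Real.pi ^ 2 * ‖ξ‖ ^ 2 := by positivity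
      have : Tendsto (fun R : ℝ => Real.pi ^ 2 * ‖ξ‖ ^ 2 * R ^ 2) atTop atTop :=
        (tendsto_pow_atTop two_ne_zero).const_mul_atTop hc
      refine (Real.tendsto_exp_neg_atTop_nhds_zero.comp this).congr fun R => ?_
      simp only [Function.comp]
      congr 1; ring
  obtain ⟨L, hL⟩ := hlim
  have hT : Tendsto (fun R : ℝ => dampedCauchy f R z) atTop
      (𝓝 (dampedCauchy f 1 z + -Complex.I * L)) := by
    refine ((hL.const_mul (-Complex.I)).const_add (dampedCauchy f 1 z)).congr' ?_
    filter_upwards [eventually_ge_atTop 1] with R hR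
    rw [← damped_sub_damped h1 h2 hf hz one_pos hR]
    ring
  -- The limit was built from the scale `1`, but the bound holds from every scale `r`.
  refine ⟨_, hT, fun r hr => ?_⟩
  refine le_of_tendsto hT.norm ?_
  filter_upwards [eventually_ge_atTop r] with R hR
  have hd := damped_sub_damped h1 h2 hf hz hr hR
  have hn : ‖dampedCauchy f R z - dampedCauchy f r z‖ ≤
      8 * Real.pi * (maximalFunction (fourierLp h1 h2 hf) 0).toReal / r := by
    obtain ⟨hi, hb⟩ := integrable_fourier_majorant h1 h2 hf hN hr
    rw [hd, norm_mul, norm_neg, Complex.norm_I, one_mul]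
    exact (norm_integral_le_of_norm_le hi (Eventually.of_forall (hbound r R hr hR))).trans hb
  have := norm_add_le (dampedCauchy f r z) (dampedCauchy f R z - dampedCauchy f r z)
  rw [add_sub_cancel] at this
  linarith

/-- Convergence of the improper Cauchy integral, with the two-scale bound. -/
theorem tendsto_truncatedCauchy (h1 : 1 ≤ p) (h2 : p ≤ 2) (hf : MemLp f p volume)
    (hN : maximalFunction (fourierLp h1 h2 hf) 0 < ∞)
    (hz : Integrable (fun w => highPart f w / (z - w)) volume) :
    Tendsto (fun R : ℝ => truncatedCauchy f R z) atTop (𝓝 (solidCauchy f z)) ∧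
      ∀ r : ℝ, 0 < r → Real.pi * ‖solidCauchy f z‖ ≤ ‖dampedCauchy f r z‖ +
        8 * Real.pi * (maximalFunction (fourierLp h1 h2 hf) 0).toReal / r := by
  obtain ⟨G, hG, hb⟩ := exists_tendsto_dampedCauchy h1 h2 hf hN hz
  have ht : Tendsto (fun R : ℝ => truncatedCauchy f R z) atTop (𝓝 ((Real.pi : ℂ)⁻¹ * G)) := by
    have := ((tendsto_truncated_sub_damped h1 h2 hf hz).add hG).const_mul ((Real.pi : ℂ)⁻¹)
    rw [zero_add] at this
    refine this.congr fun R => ?_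
    rw [sub_add_cancel, truncatedCauchy]
  have hs : solidCauchy f z = (Real.pi : ℂ)⁻¹ * G := ht.limUnder_eq
  refine ⟨hs ▸ ht, fun r hr => ?_⟩
  rw [hs, norm_mul, norm_inv, Complex.norm_real, Real.norm_of_nonneg Real.pi_pos.le,
    mul_inv_cancel_left₀ Real.pi_ne_zero]
  exact hb r hr

end Limit

/-! ### Absolute convergence for `p < 2` -/

section Absolute
variable {f : ℂ → ℂ} {p : ℝ≥0∞}

/-- Near the pole the Cauchy kernel is integrable and the low part bounded; far from it, Young's
inequality applies, since the conjugate exponent of `p < 2` exceeds `2`. -/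
theorem integrable_lowPart_div (h1 : 1 < p) (h2 : p < 2) (hf : MemLp f p volume) (z : ℂ) :
    Integrable (fun w => lowPart f w / (z - w)) volume := by
  have hpt : p ≠ ∞ := (h2.trans (by simp)).ne
  have hp1 : 1 < p.toReal := by
    simpa using (ENNReal.toReal_lt_toReal (by simp) hpt).2 h1
  have hp2 : p.toReal < 2 := by
    simpa using (ENNReal.toReal_lt_toReal hpt (by simp)).2 h2
  have hpq := Real.HolderConjugate.conjExponent hp1
  set q := p.toReal.conjExponent
  have hq2 : 2 < q := by
    rw [show q = p.toReal / (p.toReal - 1) from rfl, lt_div_iff₀ (by linarith)]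
    linarith
  have hdec : Integrable (fun w : ℂ => (2 : ℝ) ^ q * (1 + ‖w - z‖) ^ (-q)) volume :=
    ((integrable_one_add_norm (E := ℂ) (r := q) (by simpa using hq2)).comp_sub_right z).const_mul _
  have hker := (integrable_gaussian_div_norm z one_pos).const_mul (Real.exp 1)
  have hfp := hf.integrable_norm_rpow (by positivity) hpt
  refine Integrable.mono' ((hker.add hfp).add hdec)
    ((memLp_lowPart h1.le h2.le hf).1.mul
    (by fun_prop : AEStronglyMeasurable (fun w : ℂ => (z - w)⁻¹) _))
    (Eventually.of_forall fun w => ?_)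
  rw [norm_div, norm_sub_rev, div_eq_mul_inv]
  simp only [Pi.add_apply]
  have hk0 : 0 ≤ Real.exp 1 * (Real.exp (-(‖w - z‖ ^ 2 / 1 ^ 2)) / ‖w - z‖) := by positivity
  have hf0 : 0 ≤ ‖f w‖ ^ p.toReal := by positivity
  have hd0 : 0 ≤ (2 : ℝ) ^ q * (1 + ‖w - z‖) ^ (-q) := by positivity
  rcases le_or_gt ‖w - z‖ 1 with h | h
  · have h3 : 1 ≤ Real.exp 1 * Real.exp (-(‖w - z‖ ^ 2 / 1 ^ 2)) := by
      rw [← Real.exp_add]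
      refine Real.one_le_exp ?_
      nlinarith [norm_nonneg (w - z)]
    have : ‖lowPart f w‖ * ‖w - z‖⁻¹ ≤
        Real.exp 1 * (Real.exp (-(‖w - z‖ ^ 2 / 1 ^ 2)) / ‖w - z‖) := by
      rw [div_eq_mul_inv, ← mul_assoc]
      gcongr
      exact (norm_lowPart_le_one f w).trans h3
    linarith
  · have hy := Real.young_inequality_of_nonneg (norm_nonneg (lowPart f w))
      (inv_nonneg.2 (norm_nonneg (w - z))) hpq
    have e1 : ‖lowPart f w‖ ^ p.toReal / p.toReal ≤ ‖f w‖ ^ p.toReal := by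
      refine (div_le_self (by positivity) hp1.le).trans ?_
      gcongr
      exact norm_lowPart_le f w
    have e2 : ‖w - z‖⁻¹ ^ q / q ≤ (2 : ℝ) ^ q * (1 + ‖w - z‖) ^ (-q) := by
      refine (div_le_self (by positivity) (by linarith)).trans ?_
      rw [Real.rpow_neg (by positivity), ← Real.inv_rpow (by positivity),
        ← Real.mul_rpow (by positivity) (by positivity)]
      gcongr
      rw [inv_le_iff_one_le_mul₀ (by positivity), mul_right_comm, ← div_eq_mul_inv,
        le_div_iff₀ (by positivity)]
      linarith
    linarith

/-- For `1 < p < 2` the Cauchy integral converges absolutely almost everywhere. -/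
theorem ae_integrable_div (h1 : 1 < p) (h2 : p < 2) (hf : MemLp f p volume) :
    ∀ᵐ z : ℂ, Integrable (fun w => f w / (z - w)) volume := by
  filter_upwards [ae_integrable_highPart_div h1.le h2.le hf] with z hz
  simp_rw [div_eq_high_add_low f]
  exact hz.add (integrable_lowPart_div h1 h2 hf z)

theorem solidCauchy_eq_integral {z : ℂ} (hz : Integrable (fun w => f w / (z - w)) volume) :
    solidCauchy f z = (Real.pi : ℂ)⁻¹ * ∫ w : ℂ, f w / (z - w) :=
  (((aecover_ball (μ := (volume : Measure ℂ)) (x := 0)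
      (tendsto_id (α := ℝ) (x := atTop))).integral_tendsto_of_countably_generated
      hz).const_mul _).limUnder_eq

end Absolute

/-! ### The pointwise estimate -/

section Estimate
variable {f : ℂ → ℂ} {p : ℝ≥0∞} {z : ℂ}

theorem ae_eq_zero_of_maximalFunction_eq_zero (hf : AEStronglyMeasurable f volume)
    (h0 : maximalFunction f z = 0) : ∀ᵐ w, f w = 0 := by
  have hb : ∀ n : ℕ, ∀ᵐ w, w ∈ ball z (n + 1) → f w = 0 := by
    intro n
    have hn : (0 : ℝ) < n + 1 := by positivity
    have h := (iSup₂_le_iff.1 h0.le) (n + 1) hn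
    have h' : ∫⁻ y in ball z ((n : ℝ) + 1), ‖f y‖ₑ = 0 := by
      rcases mul_eq_zero.1 (le_antisymm h bot_le) with h | h
      · exact absurd (ENNReal.inv_eq_zero.1 h) measure_ball_lt_top.ne
      · exact h
    rw [lintegral_eq_zero_iff' hf.restrict.enorm] at h'
    have h3 := (ae_restrict_iff' measurableSet_ball).1 h'
    filter_upwards [h3] with w hw hwb
    simpa using hw hwb
  filter_upwards [ae_all_iff.2 hb] with w hw
  obtain ⟨n, hn⟩ := exists_nat_gt (dist w z)
  exact hw n (mem_ball.2 (hn.trans (by linarith)))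

theorem solidCauchy_eq_zero (h : ∀ᵐ w, f w = 0) : solidCauchy f z = 0 := by
  have : (fun R : ℝ => truncatedCauchy f R z) = fun _ => 0 := by
    ext R
    have : ∫ w in ball (0 : ℂ) R, f w / (z - w) = ∫ w in ball (0 : ℂ) R, (0 : ℂ) := by
      refine integral_congr_ae (ae_restrict_of_ae ?_)
      filter_upwards [h] with w hw
      rw [hw, zero_div]
    rw [truncatedCauchy, this, integral_zero, mul_zero]
  rw [solidCauchy, this]
  exact tendsto_const_nhds.limUnder_eq

/-- When both maximal functions are finite and positive, the two-scale bound is optimised by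
balancing its two terms. -/
theorem norm_solidCauchy_le (h1 : 1 ≤ p) (h2 : p ≤ 2) (hf : MemLp f p volume)
    (hm0 : maximalFunction f z ≠ 0) (hm : maximalFunction f z < ∞)
    (hn0 : maximalFunction (fourierLp h1 h2 hf) 0 ≠ 0)
    (hn : maximalFunction (fourierLp h1 h2 hf) 0 < ∞) :
    ‖solidCauchy f z‖ ≤ (8 * Real.pi + 8) * (maximalFunction f z).toReal ^ (1 / 2 : ℝ) *
      (maximalFunction (fourierLp h1 h2 hf) 0).toReal ^ (1 / 2 : ℝ) := by
  have hm' := ENNReal.toReal_pos hm0 hm.ne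
  have hn' := ENNReal.toReal_pos hn0 hn.ne
  have hz := integrable_highPart_div_of_maximalFunction h1 h2 hf hm
  have hb := (tendsto_truncatedCauchy h1 h2 hf hn hz).2
  have hd : ∀ r : ℝ, 0 < r → _ := fun r hr => norm_dampedCauchy_le hf.1 hm hr
  set m := (maximalFunction f z).toReal
  set n := (maximalFunction (fourierLp h1 h2 hf) 0).toReal
  rw [← Real.sqrt_eq_rpow, ← Real.sqrt_eq_rpow]
  have hsm := Real.sqrt_pos.2 hm'
  have hsn := Real.sqrt_pos.2 hn'
  have em : m = √m * √m := (Real.mul_self_sqrt hm'.le).symm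
  have en : n = √n * √n := (Real.mul_self_sqrt hn'.le).symm
  have hr : 0 < √n / √m := by positivity
  have h := (hb _ hr).trans (add_le_add_left (hd _ hr) _)
  have e1 : 8 * Real.pi ^ 2 * (√n / √m) * m = Real.pi * (8 * Real.pi * √m * √n) := by
    conv_lhs => rw [em]
    field_simp
    rw [Real.sqrt_sq hsm.le]
  have e2 : 8 * Real.pi * n / (√n / √m) = Real.pi * (8 * √m * √n) := by
    conv_lhs => rw [en]
    field_simp
    rw [Real.sqrt_sq hsn.le]
  rw [e1, e2, ← mul_add] at h
  have := le_of_mul_le_mul_left h Real.pi_pos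
  linarith

/-- The degenerate cases of the estimate: if either maximal function vanishes then `f = 0` almost
everywhere, and otherwise an infinite factor makes the right-hand side infinite. -/
theorem enorm_solidCauchy_le (h1 : 1 ≤ p) (h2 : p ≤ 2) (hf : MemLp f p volume) (z : ℂ) :
    ‖solidCauchy f z‖ₑ ≤ ((8 * NNReal.pi + 8 : ℝ≥0) : ℝ≥0∞) * maximalFunction f z ^ (1 / 2 : ℝ) *
      maximalFunction (fourierLp h1 h2 hf) 0 ^ (1 / 2 : ℝ) := by
  by_cases hm0 : maximalFunction f z = 0
  · rw [solidCauchy_eq_zero (ae_eq_zero_of_maximalFunction_eq_zero hf.1 hm0)]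
    simp
  by_cases hn0 : maximalFunction (fourierLp h1 h2 hf) 0 = 0
  · rw [solidCauchy_eq_zero (ae_eq_zero_of_fourierLp_ae_eq_zero h1 h2 hf
      (ae_eq_zero_of_maximalFunction_eq_zero (aestronglyMeasurable_fourierLp h1 h2 hf) hn0))]
    simp
  have hC : ((8 * NNReal.pi + 8 : ℝ≥0) : ℝ≥0∞) ≠ 0 := by
    rw [ENNReal.coe_ne_zero]; positivity
  rcases eq_or_ne (maximalFunction f z) ∞ with hm | hm
  · rw [hm, ENNReal.top_rpow_of_pos (by norm_num), ENNReal.mul_top hC, ENNReal.top_mul]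
    · exact le_top
    · simp [hn0]
  rcases eq_or_ne (maximalFunction (fourierLp h1 h2 hf) 0) ∞ with hn | hn
  · rw [hn, ENNReal.top_rpow_of_pos (by norm_num), ENNReal.mul_top]
    · exact le_top
    · exact mul_ne_zero hC (by simp [hm0])
  have h := norm_solidCauchy_le h1 h2 hf hm0 hm.lt_top hn0 hn.lt_top
  rw [← ofReal_norm]
  refine (ENNReal.ofReal_le_ofReal h).trans_eq ?_
  rw [ENNReal.ofReal_mul (by positivity), ENNReal.ofReal_mul (by positivity),
    ← ENNReal.ofReal_rpow_of_nonneg (by positivity) (by norm_num),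
    ← ENNReal.ofReal_rpow_of_nonneg (by positivity) (by norm_num),
    ENNReal.ofReal_toReal hm, ENNReal.ofReal_toReal hn, ← ENNReal.ofReal_coe_nnreal]
  simp

end Estimate

end DBar

end

theorem mainTheorem7 :
    ∃ C : ℝ≥0, ∀ (p : ℝ≥0∞) (h1 : 1 < p) (h2 : p ≤ 2) (f : ℂ → ℂ) (hf : MemLp f p volume),
      -- for `p < 2` the Cauchy integral converges absolutely almost everywhere
      (p < 2 → ∀ᵐ z : ℂ, Integrable (fun w : ℂ => f w / (z - w)) volume ∧
        DBar.solidCauchy f z = (Real.pi : ℂ)⁻¹ * ∫ w : ℂ, f w / (z - w)) ∧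
      -- it converges at least as an improper integral when the right-hand side is finite
      (DBar.maximalFunction (DBar.fourierLp h1.le h2 hf) 0 < ∞ → ∀ᵐ z : ℂ,
        (∀ R : ℝ, IntegrableOn (fun w : ℂ => f w / (z - w)) (ball 0 R) volume) ∧
        Tendsto (fun R : ℝ => DBar.truncatedCauchy f R z) atTop (𝓝 (DBar.solidCauchy f z))) ∧
      -- the pointwise estimate
      ∀ z : ℂ, ‖DBar.solidCauchy f z‖ₑ ≤
        (C : ℝ≥0∞) * DBar.maximalFunction f z ^ (1 / 2 : ℝ) *
          DBar.maximalFunction (DBar.fourierLp h1.le h2 hf) 0 ^ (1 / 2 : ℝ) := by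
  refine ⟨8 * NNReal.pi + 8, fun p h1 h2 f hf => ⟨fun hp => ?_, fun hN => ?_,
    DBar.enorm_solidCauchy_le h1.le h2 hf⟩⟩
  · filter_upwards [DBar.ae_integrable_div h1 hp hf] with z hz
    exact ⟨hz, DBar.solidCauchy_eq_integral hz⟩
  · filter_upwards [DBar.ae_integrable_highPart_div h1.le h2 hf] with z hz
    exact ⟨DBar.integrableOn_div h1.le h2 hf hz,
      (DBar.tendsto_truncatedCauchy h1.le h2 hf hN hz).1⟩
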